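/- Let $E$ be a finite-dimensional real vector space and $\Phi\subset E^*$ a reduced crystallographic root system (spanning $E^*$) with Weyl group $W$, a chosen set of positive roots $\Phi_+$, simple roots $\alpha_i$ and simple reflections $s_i$. Let $P\subset E^*$ be the weight lattice, that is, the lattice dual to the one generated by the coroots, $\mathfrak h=\mathrm{Hom}_{\mathbb Z}(P,\mathbb C)$, $H=\mathrm{Hom}_{\mathbb Z}(P,\mathbb C^*)$ and $H_{\mathrm{reg}}=H\setminus\bigcup_{\alpha\in\Phi}\{e^\alpha=1\}$. Let $A$ be an associative unital $\mathbb C$-algebra on which $W$ acts by algebra automorphisms, let $t_\alpha\in A$ $(\alpha\in\Phi)$ be elements with $t_{-\alpha}=t_\alpha$, and let $\tau:\mathfrak h\to A$ be a linear map. Consider the $A$-valued connection $$\nabla=d-\sum_{\alpha\in\Phi_+}\frac{d\alpha}{e^\alpha-1}\,t_\alpha-du_i\,\tau(u^i)$$ on $H_{\mathrm{reg}}$, where $\{u_i\},\{u^i\}$ are dual bases of $\mathfrak h^*$ and $\mathfrak h$, the $du_i$ are regarded as translation-invariant one-forms, and summation over $i$ is implicit. A root subsystem of $\Phi$ is a subset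 $\Psi\subset\Phi$ with $\langle\Psi\rangle_{\mathbb Z}\cap\Phi=\Psi$, where $\langle\Psi\rangle_{\mathbb Z}$ is the $\mathbb Z$-span of $\Psi$; its rank is the dimension of its real span, and $\Psi_+=\Psi\cap\Phi_+$. 1. The connection $\nabla$ is flat and $W$-equivariant (for the action of $W$ both on $H_{\mathrm{reg}}$ and on $A$) if and only if the following relations hold: (a) $[t_\alpha,\sum_{\beta\in\Psi_+}t_\beta]=0$ for every rank 2 root subsystem $\Psi\subset\Phi$ and every $\alpha\in\Psi$; (b) $[\tau(u),\tau(v)]=0$ for all $u,v\in\mathfrak h$; (c) $[t_{\alpha_i},\tau(u)]=0$ for every simple root $\alpha_i$ and every $u\in\mathrm{Ker}(\alpha_i)\subset\mathfrak h$; (d) $s_i(t_\alpha)=t_{s_i\alpha}$ for every $\alpha\in\Phi$ and every simple reflection $s_i$; (e) $s_i(\tau(u))-\tau(s_iu)=\alpha_i(u)\,t_{\alpha_i}$ for every simple reflection $s_i$ and every $u\in\mathfrak h$. 2. The connection $\nabla$ is $W$-equivariant if and only if (d) and (e) hold. 3. If (d) holds, then (e) holds if and only if the linear map $\delta:\mathfrak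 h\to A$, $\delta(v)=\tau(v)-\frac12\sum_{\alpha\in\Phi_+}\alpha(v)\,t_\alpha$, is $W$-equivariant. -/

import Mathlib

open scoped TensorProduct

noncomputable section

namespace TrigConn

variable {ι V E : Type*} [AddCommGroup V] [Module ℝ V] [AddCommGroup E] [Module ℝ E]

/-- The weight lattice `P = {x ∈ E* | ⟨x, α^∨⟩ ∈ ℤ for every root α}`; here `V = E*`. -/
def weightLattice (Φ : RootPairing ι ℝ V E) : AddSubgroup V where
  carrier := {x | ∀ i, ∃ n : ℤ, Φ.toLinearMap x (Φ.coroot i) = n}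
  zero_mem' := fun _ => ⟨0, by rw [map_zero, LinearMap.zero_apply, Int.cast_zero]⟩
  add_mem' := by
    intro x y hx hy i
    obtain ⟨m, hm⟩ := hx i
    obtain ⟨n, hn⟩ := hy i
    exact ⟨m + n, by rw [map_add, LinearMap.add_apply, hm, hn, Int.cast_add]⟩
  neg_mem' := by
    intro x hx i
    obtain ⟨m, hm⟩ := hx i
    exact ⟨-m, by rw [map_neg, LinearMap.neg_apply, hm, Int.cast_neg]⟩

/-- The root with index `i`, as an element of the weight lattice. -/
def rootWt (Φ : RootPairing ι ℝ V E) [Φ.IsCrystallographic] (i : ι) : weightLattice Φ :=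
  ⟨Φ.root i, fun j => ⟨Φ.pairingIn ℤ i j, 
    (Φ.algebraMap_pairingIn ℤ i j).symm.trans (eq_intCast _ _)⟩⟩

/-- The complex Lie algebra `𝔥 = Hom_ℤ(P, ℂ)` of the torus `H = Hom_ℤ(P, ℂˣ)`. The natural pairing
of `x ∈ P` with `v ∈ 𝔥` is `v x`. -/
abbrev Cartan (Φ : RootPairing ι ℝ V E) : Type _ := weightLattice Φ →+ ℂ

/-- The coordinate ring `ℂ[H] = ℂP` of `H`. -/
abbrev TorusRing (Φ : RootPairing ι ℝ V E) : Type _ := AddMonoidAlgebra ℂ (weightLattice Φ)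

/-- The character `e^x` of `H`, for `x ∈ P`. -/
def expo {Φ : RootPairing ι ℝ V E} (x : weightLattice Φ) : TorusRing Φ :=
  AddMonoidAlgebra.of ℂ (weightLattice Φ) (Multiplicative.ofAdd x)

lemma expo_zero {Φ : RootPairing ι ℝ V E} : expo (0 : weightLattice Φ) = 1 := rfl

lemma expo_add {Φ : RootPairing ι ℝ V E} (x y : weightLattice Φ) : expo (x + y) = expo x * expo y := by
  simp [expo]

/-- The multiplicative set generated by the functions `e^α - 1`, `α ∈ Φ`. -/
def rootDenoms (Φ : RootPairing ι ℝ V E) [Φ.IsCrystallographic] : Submonoid (TorusRing Φ) :=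
  Submonoid.closure (Set.range fun i => expo (rootWt Φ i) - 1)

/-- The coordinate ring `ℂ[H_reg]` of the affine variety `H_reg = H ∖ ⋃_α {e^α = 1}`. -/
def RegRing (Φ : RootPairing ι ℝ V E) [Φ.IsCrystallographic] : Type _ :=
  Localization (rootDenoms Φ)

section Instances

variable (Φ : RootPairing ι ℝ V E) [Φ.IsCrystallographic]

instance : CommRing (RegRing Φ) := inferInstanceAs (CommRing (Localization (rootDenoms Φ)))

instance : Algebra (TorusRing Φ) (RegRing Φ) :=
  inferInstanceAs (Algebra (TorusRing Φ) (Localization (rootDenoms Φ)))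

instance : Algebra ℂ (RegRing Φ) :=
  ((algebraMap (TorusRing Φ) (RegRing Φ)).comp (algebraMap ℂ (TorusRing Φ))).toAlgebra

instance : IsScalarTower ℂ (TorusRing Φ) (RegRing Φ) :=
  IsScalarTower.of_algebraMap_eq fun _ => rfl

instance : IsLocalization (rootDenoms Φ) (RegRing Φ) :=
  inferInstanceAs (IsLocalization (rootDenoms Φ) (Localization (rootDenoms Φ)))

end Instances

/-- The character `e^x` as a function on `H_reg`. -/
def regExpo (Φ : RootPairing ι ℝ V E) [Φ.IsCrystallographic] (x : weightLattice Φ) : RegRing Φ :=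
  algebraMap (TorusRing Φ) (RegRing Φ) (expo x)

/-- The function `1 / (e^α - 1)` on `H_reg`. -/
def invDenom (Φ : RootPairing ι ℝ V E) [Φ.IsCrystallographic] (i : ι) : RegRing Φ :=
  IsLocalization.mk' (RegRing Φ) (1 : TorusRing Φ)
    (⟨expo (rootWt Φ i) - 1, Submonoid.subset_closure ⟨i, rfl⟩⟩ : rootDenoms Φ)

section Functions

variable (Φ : RootPairing ι ℝ V E) [Φ.IsCrystallographic]

lemma regExpo_zero : regExpo Φ 0 = 1 := by
  rw [regExpo, expo_zero, map_one]

lemma regExpo_add (x y : weightLattice Φ) : regExpo Φ (x + y) = regExpo Φ x * regExpo Φ y := by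
  rw [regExpo, expo_add, map_mul]; rfl

lemma isUnit_regExpo_sub_one (i : ι) : IsUnit (regExpo Φ (rootWt Φ i) - 1) := by
  have h := IsLocalization.map_units (RegRing Φ)
    (⟨expo (rootWt Φ i) - 1, Submonoid.subset_closure ⟨i, rfl⟩⟩ : rootDenoms Φ)
  simpa [regExpo] using h

lemma invDenom_mul (i : ι) : invDenom Φ i * (regExpo Φ (rootWt Φ i) - 1) = 1 := by
  have h := IsLocalization.mk'_spec (RegRing Φ) (1 : TorusRing Φ)
    (⟨expo (rootWt Φ i) - 1, Submonoid.subset_closure ⟨i, rfl⟩⟩ : rootDenoms Φ)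
  simpa [invDenom, regExpo] using h

/-- The homomorphism `ℂP → ℂ[H_reg][ε]`, `e^x ↦ (1 + ε x(v)) e^x`: the translation of functions by
the infinitesimal vector `ε v`. -/
def torusShift (v : Cartan Φ) : TorusRing Φ →ₐ[ℂ] TrivSqZeroExt (RegRing Φ) (RegRing Φ) :=
  AddMonoidAlgebra.lift ℂ (TrivSqZeroExt (RegRing Φ) (RegRing Φ)) (weightLattice Φ)
    { toFun := fun x => TrivSqZeroExt.inl (regExpo Φ x.toAdd) +
        TrivSqZeroExt.inr (v x.toAdd • regExpo Φ x.toAdd)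
      map_one' := by
        ext
        · simp [regExpo_zero]
        · simp
      map_mul' := by
        intro x y
        ext
        · simp [regExpo_add]
        · simp [regExpo_add, add_smul, mul_comm, add_comm] }

lemma torusShift_expo (v : Cartan Φ) (x : weightLattice Φ) :
    torusShift Φ v (expo x) = TrivSqZeroExt.inl (regExpo Φ x) +
      TrivSqZeroExt.inr (v x • regExpo Φ x) := by
  simp [torusShift, expo]

lemma isUnit_torusShift (v : Cartan Φ) (y : rootDenoms Φ) :
    IsUnit (torusShift Φ v (y : TorusRing Φ)) := by
  obtain ⟨y, hy⟩ := y
  induction hy using Submonoid.closure_induction with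
  | mem y hy =>
    obtain ⟨i, rfl⟩ := hy
    rw [TrivSqZeroExt.isUnit_iff_isUnit_fst]
    simpa [torusShift_expo] using isUnit_regExpo_sub_one Φ i
  | one => simp
  | mul a b _ _ ha hb => simpa using ha.mul hb

/-- The extension of `torusShift` to `ℂ[H_reg]`. -/
def regShift (v : Cartan Φ) : RegRing Φ →ₐ[ℂ] TrivSqZeroExt (RegRing Φ) (RegRing Φ) :=
  IsLocalization.liftAlgHom (M := rootDenoms Φ) (f := torusShift Φ v) (isUnit_torusShift Φ v)

lemma regShift_regExpo (v : Cartan Φ) (x : weightLattice Φ) :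
    regShift Φ v (regExpo Φ x) = TrivSqZeroExt.inl (regExpo Φ x) +
      TrivSqZeroExt.inr (v x • regExpo Φ x) := by
  rw [regShift, IsLocalization.liftAlgHom_apply, regExpo, IsLocalization.lift_eq]
  exact torusShift_expo Φ v x

lemma fst_regShift (v : Cartan Φ) (f : RegRing Φ) : (regShift Φ v f).fst = f := by
  have h : ((TrivSqZeroExt.fstHom ℂ (RegRing Φ) (RegRing Φ)).comp (regShift Φ v) :
      RegRing Φ →+* RegRing Φ) = RingHom.id _ := by
    refine IsLocalization.ringHom_ext (rootDenoms Φ) ?_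
    have h' : (((TrivSqZeroExt.fstHom ℂ (RegRing Φ) (RegRing Φ)).comp (regShift Φ v)).comp
        (IsScalarTower.toAlgHom ℂ (TorusRing Φ) (RegRing Φ))) =
        IsScalarTower.toAlgHom ℂ (TorusRing Φ) (RegRing Φ) := by
      refine AddMonoidAlgebra.algHom_ext' ?_ ?_
      · ext x
        have := congrArg TrivSqZeroExt.fst (regShift_regExpo Φ v x)
        simpa [regExpo, expo] using this
      · exact Subsingleton.elim _ _
    exact congrArg (fun g : TorusRing Φ →ₐ[ℂ] RegRing Φ => (g : TorusRing Φ →+* RegRing Φ)) h'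
  exact RingHom.congr_fun h f

/-- The translation-invariant vector field on `H_reg` with value `v ∈ 𝔥`: the derivation of
`ℂ[H_reg]` with `∂_v e^x = x(v) e^x`. -/
def vectorField (v : Cartan Φ) : Derivation ℂ (RegRing Φ) (RegRing Φ) :=
  Derivation.mk'
    { toFun := fun f => (regShift Φ v f).snd
      map_add' := fun f g => by simp
      map_smul' := fun c f => by simp }
    (fun f g => by simp [fst_regShift, mul_comm])

lemma vectorField_regExpo (v : Cartan Φ) (x : weightLattice Φ) :
    vectorField Φ v (regExpo Φ x) = v x • regExpo Φ x := by
  have := congrArg TrivSqZeroExt.snd (regShift_regExpo Φ v x)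
  simpa [vectorField] using this

end Functions

section Weyl

variable (Φ : RootPairing ι ℝ V E)

lemma weyl_smul_mem (w : Φ.weylGroup) {x : V} (hx : x ∈ weightLattice Φ) :
    w • x ∈ weightLattice Φ := by
  intro i
  obtain ⟨n, hn⟩ := hx ((w : Φ.Aut).indexEquiv.symm i)
  refine ⟨n, ?_⟩
  rw [← hn, ← RootPairing.Hom.coroot_coweightMap_apply]
  exact LinearMap.congr_fun
    (RootPairing.Hom.weight_coweight_transpose_apply Φ Φ (Φ.coroot i) (w : Φ.Aut).toHom) x

/-- The action of the Weyl group on the weight lattice. -/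
def weylWt (w : Φ.weylGroup) : weightLattice Φ ≃+ weightLattice Φ where
  toFun x := ⟨w • (x : V), weyl_smul_mem Φ w x.2⟩
  invFun x := ⟨w⁻¹ • (x : V), weyl_smul_mem Φ w⁻¹ x.2⟩
  left_inv x := by simp
  right_inv x := by simp
  map_add' x y := by ext; simp

/-- The action of the Weyl group on `𝔥`, `(w v)(x) = v(w⁻¹ x)`. -/
def weylCartan (w : Φ.weylGroup) : Cartan Φ →ₗ[ℂ] Cartan Φ where
  toFun v := v.comp (weylWt Φ w⁻¹).toAddMonoidHom
  map_add' _ _ := rfl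
  map_smul' _ _ := rfl

variable [Φ.IsCrystallographic]

lemma weylWt_rootWt (w : Φ.weylGroup) (i : ι) :
    weylWt Φ w (rootWt Φ i) = rootWt Φ (Φ.weylGroupToPerm w i) :=
  Subtype.ext (Φ.weylGroup_apply_root w i)

/-- `ℂP → ℂ[H_reg]`, `e^x ↦ e^{wx}`. -/
def weylTorus (w : Φ.weylGroup) : TorusRing Φ →ₐ[ℂ] RegRing Φ :=
  (IsScalarTower.toAlgHom ℂ (TorusRing Φ) (RegRing Φ)).comp
    (AddMonoidAlgebra.domCongr ℂ ℂ (weylWt Φ w)).toAlgHom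

lemma weylTorus_expo (w : Φ.weylGroup) (x : weightLattice Φ) :
    weylTorus Φ w (expo x) = regExpo Φ (weylWt Φ w x) := by
  simp [weylTorus, expo, regExpo]

lemma isUnit_weylTorus (w : Φ.weylGroup) (y : rootDenoms Φ) :
    IsUnit (weylTorus Φ w (y : TorusRing Φ)) := by
  obtain ⟨y, hy⟩ := y
  induction hy using Submonoid.closure_induction with
  | mem y hy =>
    obtain ⟨i, rfl⟩ := hy
    simpa [weylTorus_expo, weylWt_rootWt] using
      isUnit_regExpo_sub_one Φ (Φ.weylGroupToPerm w i)
  | one => simp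
  | mul a b _ _ ha hb => simpa using ha.mul hb

/-- The action of the Weyl group on functions on `H_reg`, `(w f)(h) = f(w⁻¹ h)`; it is the algebra
homomorphism with `w e^x = e^{wx}`. -/
def weylFun (w : Φ.weylGroup) : RegRing Φ →ₐ[ℂ] RegRing Φ :=
  IsLocalization.liftAlgHom (M := rootDenoms Φ) (f := weylTorus Φ w) (isUnit_weylTorus Φ w)

lemma weylFun_regExpo (w : Φ.weylGroup) (x : weightLattice Φ) :
    weylFun Φ w (regExpo Φ x) = regExpo Φ (weylWt Φ w x) := by
  rw [weylFun, IsLocalization.liftAlgHom_apply, regExpo, IsLocalization.lift_eq]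
  exact weylTorus_expo Φ w x

end Weyl

section Connection

variable [Fintype ι] {A : Type*} [Ring A] [Algebra ℂ A]
variable (Φ : RootPairing ι ℝ V E) [Φ.IsCrystallographic]

open Classical in
/-- The finite set of (indices of) positive roots for the base `b`. -/
def posRoots {Φ : RootPairing ι ℝ V E} (b : Φ.Base) : Finset ι :=
  Finset.univ.filter fun i => b.IsPos i

/-- The `A`-valued one-form `∑_{α > 0} dα / (e^α - 1) t_α + du_i τ(u^i)` on `H_reg`, evaluated on the
translation-invariant vector field `v`; since `dα(v) = α(v)` and `u_i(v) u^i = v`, the value is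
`∑_{α > 0} α(v) / (e^α - 1) t_α + τ(v)`. -/
def connForm (b : Φ.Base) (t : ι → A) (τ : Cartan Φ →ₗ[ℂ] A) (v : Cartan Φ) : RegRing Φ ⊗[ℂ] A :=
  ∑ i ∈ posRoots b, (v (rootWt Φ i) • invDenom Φ i) ⊗ₜ[ℂ] t i + 1 ⊗ₜ[ℂ] τ v

/-- The trigonometric connection
`∇ = d - ∑_{α > 0} dα / (e^α - 1) t_α - du_i τ(u^i)`
on the trivial bundle over `H_reg` with fibre `A`, on which `A` acts by left multiplication:
`trigConn Φ b t τ v` is the covariant derivative `∇_v`, acting on the sections `ℂ[H_reg] ⊗ A`, along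
the translation-invariant vector field `v`. -/
def trigConn (b : Φ.Base) (t : ι → A) (τ : Cartan Φ →ₗ[ℂ] A) (v : Cartan Φ) :
    Module.End ℂ (RegRing Φ ⊗[ℂ] A) :=
  LinearMap.rTensor A (vectorField Φ v).toLinearMap -
    LinearMap.mulLeft ℂ (connForm Φ b t τ v)

/-- Flatness: the curvature `[∇_u, ∇_v] - ∇_{[u, v]}` vanishes. It is enough to take `u, v`
translation-invariant: these commute with each other and form a global frame of the tangent
bundle. -/
def IsFlat (D : Cartan Φ → Module.End ℂ (RegRing Φ ⊗[ℂ] A)) : Prop :=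
  ∀ u v, ⁅D u, D v⁆ = 0

/-- The action of `w ∈ W` on sections, by transport of the point of `H_reg` and through the given
action of `W` on `A`. -/
def weylSection (ρ : Φ.weylGroup →* (A ≃ₐ[ℂ] A)) (w : Φ.weylGroup) :
    RegRing Φ ⊗[ℂ] A →ₗ[ℂ] RegRing Φ ⊗[ℂ] A :=
  TensorProduct.map (weylFun Φ w).toLinearMap (ρ w).toLinearMap

/-- `W`-equivariance of a connection: `w (∇_v s) = ∇_{wv} (w s)` for all `w`, `v` and sections
`s`. -/
def IsWeylEquivariant (ρ : Φ.weylGroup →* (A ≃ₐ[ℂ] A))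
    (D : Cartan Φ → Module.End ℂ (RegRing Φ ⊗[ℂ] A)) : Prop :=
  ∀ w v s, weylSection Φ ρ w (D v s) = D (weylCartan Φ w v) (weylSection Φ ρ w s)

/-- The map `δ(v) = τ(v) - 1/2 ∑_{α > 0} α(v) t_α`. -/
def delta (b : Φ.Base) (t : ι → A) (τ : Cartan Φ →ₗ[ℂ] A) (v : Cartan Φ) : A :=
  τ v - (1 / 2 : ℂ) • ∑ i ∈ posRoots b, v (rootWt Φ i) • t i

end Connection

section Relations

variable {A : Type*} [Ring A] [Algebra ℂ A]
variable (Φ : RootPairing ι ℝ V E)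

/-- `s_i(t_α) = t_{s_i α}` for all roots `α` and simple reflections `s_i`. -/
def TEquivariant (b : Φ.Base) (ρ : Φ.weylGroup →* (A ≃ₐ[ℂ] A)) (t : ι → A) : Prop :=
  ∀ i ∈ b.support, ∀ j,
    ρ (RootPairing.weylGroup.ofIdx Φ i) (t j) = t (Φ.reflectionPerm i j)

/-- `s_i(τ(u)) - τ(s_i u) = α_i(u) t_{α_i}` for all `u ∈ 𝔥` and simple reflections `s_i`. -/
def TauTwisted [Φ.IsCrystallographic] (b : Φ.Base) (ρ : Φ.weylGroup →* (A ≃ₐ[ℂ] A)) (t : ι → A)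
    (τ : Cartan Φ →ₗ[ℂ] A) : Prop :=
  ∀ i ∈ b.support, ∀ u : Cartan Φ,
    ρ (RootPairing.weylGroup.ofIdx Φ i) (τ u) -
      τ (weylCartan Φ (RootPairing.weylGroup.ofIdx Φ i) u) = u (rootWt Φ i) • t i

end Relations

/-- A root subsystem of rank 2: a set of roots `Ψ` with `⟨Ψ⟩_ℤ ∩ Φ = Ψ` whose span has dimension
2. -/
def IsRankTwoSubsystem (Φ : RootPairing ι ℝ V E) (Ψ : Set ι) : Prop :=
  (∀ i, Φ.root i ∈ AddSubgroup.closure (Φ.root '' Ψ) → i ∈ Ψ) ∧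
    Module.finrank ℝ (Submodule.span ℝ (Φ.root '' Ψ)) = 2

end TrigConn

end

open scoped TensorProduct

noncomputable section

namespace TrigConn

/-! In the chamber where all `e^{-α}` with `α > 0` are small, `1/(e^α - 1) = ∑_{k ≥ 1} e^{-kα}`.
Functions on `H_reg` thus embed in Hahn series, and identities of `A`-valued functions can be tested
on the coefficients of `e^{-x}` (`exists_isExpansion`, `IsExpansion.eq_zero_of_extendFunctional`).

Let `F(v)` be the connection form. Equivariance means `w F(v) = F(wv)`, and simple reflections
suffice. Since `s_i` permutes the positive roots other than `α_i`, and `s_i (1/(e^{α_i} - 1)) = -1 -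
1/(e^{α_i} - 1)`, comparing coefficients gives exactly (d) and (e). The same sign change at `α_i`
alone gives the statement on `δ`.

The form `F` is closed, so flatness means `[F(u), F(v)] = 0`. Relation (a) is equivalent to the
string relations `StringRel`: for each root `α`, the sum of `[t_α, t_β]` over each class of roots
`β` modulo `ℤα` vanishes (`stringRel_of_rankTwo`, `lie_sum_rankTwo_eq_zero`).

If the connection is flat, the constant term of `[F(u), F(v)]` gives (b). Comparing the expansion
with the one in the chamber across the wall of `α_i`, only the factor `1/(e^{α_i} - 1)` jumps, by
`∑_{k ∈ ℤ} e^{kα_i}` (`jumpRel_of_lie_eq_zero`). The coefficients of this jump give (c) and the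
string relations for simple roots, and (d) transports the latter to all roots.

Conversely, (c) and the string relations give `[t_α, δ(u)] = 0` for `α` simple and `u ∈ Ker α`;
equivariance of `δ` extends this to all roots. In each coefficient of the curvature the string
relations turn the sum over pairs of roots into a sum over single roots (`sum_pair_coeff_eq_zero`),
which combines with the `τ` terms into commutators `[t_α, δ(u)]`, hence vanishes
(`lie_connForm_eq_zero`). -/

/-- The series `∑_{k ≥ 1} T^{k a}`, for `a > 0`. -/
def geomSeries {Γ : Type*} [AddCommGroup Γ] [LinearOrder Γ] [IsOrderedAddMonoid Γ] (a : Γ)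
    (ha : 0 < a) : HahnSeries Γ ℂ where
  coeff g := open Classical in if ∃ k : ℕ, 0 < k ∧ g = k • a then 1 else 0
  isPWO_support' := by
    have h : (Set.range fun k : ℕ => k • a).IsPWO := by
      rw [← Set.image_univ]
      exact (Set.IsWF.of_wellFoundedLT _).isPWO.image_of_monotone
        fun m n h => nsmul_le_nsmul_left ha.le h
    refine h.mono fun g hg => ?_
    by_contra hn
    exact hg (if_neg fun ⟨k, _, hk⟩ => hn ⟨k, hk.symm⟩)

/-! ### Geometric series in Hahn series -/

section Geom

variable {Γ : Type*} [AddCommGroup Γ] [LinearOrder Γ] [IsOrderedAddMonoid Γ] {a c : Γ}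

open Classical in
lemma coeff_geomSeries (ha : 0 < a) (g : Γ) :
    (geomSeries a ha).coeff g = if ∃ k : ℕ, 0 < k ∧ g = k • a then 1 else 0 := by
  rw [geomSeries]

lemma geomSeries_mul (ha : 0 < a) :
    geomSeries a ha * (HahnSeries.single (-a) 1 - 1) = 1 := by
  classical
  -- The series `S` satisfies `S = T^a (1 + S)`; multiplying by `T^{-a}` gives the claim.
  have key : geomSeries a ha = HahnSeries.single a 1 * (1 + geomSeries a ha) := by
    ext g
    rw [HahnSeries.coeff_single_mul, one_mul, HahnSeries.coeff_add, HahnSeries.coeff_one,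
      coeff_geomSeries, coeff_geomSeries]
    by_cases h0 : g - a = 0
    · have hg : g = a := sub_eq_zero.mp h0
      rw [if_pos h0, if_neg (c := ∃ k : ℕ, 0 < k ∧ g - a = k • a),
        if_pos ⟨1, one_pos, by rw [one_smul, hg]⟩, add_zero]
      rintro ⟨k, hk, h⟩
      exact (nsmul_pos ha hk.ne').ne (h0.symm.trans h)
    · rw [if_neg h0, zero_add]
      congr 1
      refine propext ⟨?_, ?_⟩
      · rintro ⟨k, hk, rfl⟩
        obtain ⟨m, rfl⟩ := Nat.exists_eq_succ_of_ne_zero hk.ne'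
        refine ⟨m, Nat.pos_of_ne_zero ?_, by rw [succ_nsmul, add_sub_cancel_right]⟩
        rintro rfl
        exact h0 (by simp)
      · rintro ⟨k, hk, h⟩
        exact ⟨k + 1, by omega, by rw [succ_nsmul, ← h, sub_add_cancel]⟩
  have h1 : HahnSeries.single (-a) (1 : ℂ) * HahnSeries.single a 1 = 1 := by
    rw [HahnSeries.single_mul_single]; simp
  calc geomSeries a ha * (HahnSeries.single (-a) 1 - 1)
      = HahnSeries.single (-a) 1 * geomSeries a ha - geomSeries a ha := by ring
    _ = HahnSeries.single (-a) 1 * (HahnSeries.single a 1 * (1 + geomSeries a ha))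
        - geomSeries a ha := by rw [← key]
    _ = 1 := by rw [← mul_assoc, h1]; ring

-- By `hac` an exponent has at most one form `k a + l c`, so at most one pair contributes to each
-- coefficient of the product.
open Classical in
lemma coeff_geomSeries_mul_geomSeries (ha : 0 < a) (hc : 0 < c)
    (hac : ∀ k l k' l' : ℕ, k • a + l • c = k' • a + l' • c → k = k' ∧ l = l') (g : Γ) :
    (geomSeries a ha * geomSeries c hc).coeff g =
      if ∃ k l : ℕ, 0 < k ∧ 0 < l ∧ g = k • a + l • c then 1 else 0 := by
  have hsupp : ∀ {a : Γ} (ha : 0 < a) {x : Γ}, x ∈ (geomSeries a ha).support ↔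
      ∃ k : ℕ, 0 < k ∧ x = k • a := by
    intro a ha x
    rw [HahnSeries.mem_support, coeff_geomSeries]
    simp
  rw [HahnSeries.coeff_mul]
  split_ifs with h
  · obtain ⟨k, l, hk, hl, rfl⟩ := h
    rw [Finset.sum_eq_single_of_mem (k • a, l • c)]
    · rw [coeff_geomSeries, coeff_geomSeries, if_pos ⟨k, hk, rfl⟩, if_pos ⟨l, hl, rfl⟩, one_mul]
    · rw [Finset.mem_antidiagonal]
      exact ⟨(hsupp ha).2 ⟨k, hk, rfl⟩, (hsupp hc).2 ⟨l, hl, rfl⟩, rfl⟩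
    · rintro ⟨x, y⟩ hxy hne
      rw [Finset.mem_antidiagonal] at hxy
      obtain ⟨hx, hy, h⟩ := hxy
      obtain ⟨k', _, rfl⟩ := (hsupp ha).1 hx
      obtain ⟨l', _, rfl⟩ := (hsupp hc).1 hy
      obtain ⟨rfl, rfl⟩ := hac _ _ _ _ h
      exact absurd rfl hne
  · refine Finset.sum_eq_zero ?_
    rintro ⟨x, y⟩ hxy
    rw [Finset.mem_antidiagonal] at hxy
    obtain ⟨hx, hy, hg⟩ := hxy
    obtain ⟨k, hk, rfl⟩ := (hsupp ha).1 hx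
    obtain ⟨l, hl, rfl⟩ := (hsupp hc).1 hy
    exact absurd ⟨k, l, hk, hl, hg.symm⟩ h

end Geom

/-! ### A linear order adapted to the positive roots -/

section Order

variable {ι V E : Type*} [AddCommGroup V] [Module ℝ V] [AddCommGroup E] [Module ℝ E]
variable {Φ : RootPairing ι ℝ V E} (b : Φ.Base)

lemma root_eq_sum_nat {i : ι} (hi : b.IsPos i) :
    ∃ f : ι → ℕ, Φ.root i = ∑ j ∈ b.support, f j • Φ.root j := by
  obtain ⟨f, _, h | h⟩ := b.exists_root_eq_sum_nat_or_neg i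
  · exact ⟨f, h⟩
  · exfalso
    have h' : Φ.root i = ∑ j ∈ b.support, (fun j => -(f j : ℤ)) j • Φ.root j := by
      rw [h, ← Finset.sum_neg_distrib]
      exact Finset.sum_congr rfl fun j _ => by simp
    rw [RootPairing.Base.isPos_iff, RootPairing.Base.height_eq_sum h'] at hi
    exact absurd hi (not_lt.mpr (Finset.sum_nonpos fun j _ => by simp))

lemma toWeightBasis_repr_nonneg [Φ.IsRootSystem] {i : ι} (hi : b.IsPos i) (m : b.support) :
    0 ≤ b.toWeightBasis.repr (Φ.root i) m := by
  classical
  obtain ⟨f, hf⟩ := root_eq_sum_nat b hi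
  rw [hf, map_sum, Finsupp.finsetSum_apply]
  refine Finset.sum_nonneg fun j hj => ?_
  rw [map_nsmul, b.toWeightBasis_repr_root ⟨j, hj⟩, Finsupp.smul_apply, Finsupp.single_apply]
  split_ifs <;> simp

/-- There is a translation-invariant linear order for which the positive roots are positive. -/
lemma exists_linearOrder [Φ.IsRootSystem] : ∃ _ : LinearOrder V, IsOrderedAddMonoid V ∧
    ∀ i, b.IsPos i → 0 < Φ.root i := by
  classical
  let e := Fintype.equivFin b.support
  -- The order is the lexicographic one on coordinates in the basis of simple roots, where positive
  -- roots have nonnegative entries.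
  let θ : V →+ Lex (Fin (Fintype.card b.support) → ℝ) :=
    { toFun := fun x => toLex fun m => b.toWeightBasis.repr x (e.symm m)
      map_zero' := congrArg toLex (by funext m; simp)
      map_add' := fun x y => congrArg toLex (by funext m; simp) }
  have hθ : Function.Injective θ := by
    intro x y h
    refine b.toWeightBasis.repr.injective (Finsupp.ext fun m => ?_)
    have h' : b.toWeightBasis.repr x (e.symm (e m)) = b.toWeightBasis.repr y (e.symm (e m)) :=
      congrFun (congrArg ofLex h) (e m)
    simpa using h'
  let o : LinearOrder V := LinearOrder.lift' θ hθ
  refine ⟨o, ⟨fun x y h z => ?_, ?_⟩, fun i hi => ?_⟩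
  · change θ _ ≤ θ _
    rw [map_add, map_add]
    exact add_le_add_left (show θ x ≤ θ y from h) _
  · intro x y h z
    change θ _ ≤ θ _
    rw [map_add, map_add]
    exact add_le_add_right (show θ x ≤ θ y from h) _
  · change θ 0 < θ _
    rw [map_zero]
    refine lt_of_le_of_ne ?_ fun h => ?_
    · exact Pi.toLex_monotone fun m => toWeightBasis_repr_nonneg b hi _
    · exact Φ.ne_zero i (hθ (by rw [← h, map_zero]))

lemma root_ne_neg_of_isPos {b : Φ.Base} {i j : ι} (hi : b.IsPos i) (hj : b.IsPos j) :
    Φ.root i ≠ -Φ.root j := by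
  intro h
  have h' := (RootPairing.Base.IsPos.neg_iff_not b j)
  have : i = Φ.reflectionPerm j j := Φ.root.injective (by simp [h])
  exact h'.1 (show b.IsPos (Φ.reflectionPerm j j) from this ▸ hi) hj

lemma linearIndependent_of_isPos [Φ.IsReduced] {b : Φ.Base} {i j : ι} (hi : b.IsPos i)
    (hj : b.IsPos j) (hij : i ≠ j) : LinearIndependent ℝ ![Φ.root i, Φ.root j] :=
  RootPairing.IsReduced.linearIndependent Φ hij (root_ne_neg_of_isPos hi hj)

end Order

/-! ### Embedding functions on `H_reg` in Hahn series -/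

section Expansion

variable {ι V E : Type*} [AddCommGroup V] [Module ℝ V] [AddCommGroup E] [Module ℝ E]
variable (Φ : RootPairing ι ℝ V E)

/-- The embedding of `ℂP` into Hahn series with `e^x ↦ T^{-x}`. -/
def torusHahn [LinearOrder V] [IsOrderedAddMonoid V] : TorusRing Φ →ₐ[ℂ] HahnSeries V ℂ :=
  AddMonoidAlgebra.lift ℂ (HahnSeries V ℂ) (weightLattice Φ)
    { toFun := fun x => HahnSeries.single (-(x.toAdd : V)) 1
      map_one' := by simp
      map_mul' := fun x y => by
        rw [HahnSeries.single_mul_single, one_mul, toAdd_mul, AddSubgroup.coe_add, neg_add] }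

lemma torusHahn_expo [LinearOrder V] [IsOrderedAddMonoid V] (x : weightLattice Φ) :
    torusHahn Φ (expo x) = HahnSeries.single (-(x : V)) 1 := by
  simp [torusHahn, expo]

lemma coeff_torusHahn [LinearOrder V] [IsOrderedAddMonoid V] (f : TorusRing Φ)
    (x : weightLattice Φ) : (torusHahn Φ f).coeff (-(x : V)) = f.coeff x := by
  classical
  induction f using AddMonoidAlgebra.induction_on with
  | of g =>
    have : (AddMonoidAlgebra.of ℂ (weightLattice Φ)) (Multiplicative.ofAdd g) = expo g := rfl
    rw [this, torusHahn_expo, HahnSeries.coeff_single]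
    simp [expo, Finsupp.single_apply, eq_comm]
  | add f g hf hg => simp [hf, hg]
  | smul r f hf => simp [hf]

lemma torusHahn_injective [LinearOrder V] [IsOrderedAddMonoid V] :
    Function.Injective (torusHahn Φ) := by
  intro f g h
  ext x
  rw [← coeff_torusHahn, h, coeff_torusHahn]

variable [Φ.IsCrystallographic]

/-- Hahn series over a linearly ordered group with coefficients in a field form a field, so
nonvanishing suffices; the constant coefficient of `T^{-α} - 1` is `-1`. -/
lemma isUnit_torusHahn [LinearOrder V] [IsOrderedAddMonoid V] (y : rootDenoms Φ) :
    IsUnit (torusHahn Φ (y : TorusRing Φ)) := by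
  refine IsUnit.mk0 _ ?_
  obtain ⟨y, hy⟩ := y
  induction hy using Submonoid.closure_induction with
  | mem y hy =>
    obtain ⟨i, rfl⟩ := hy
    simp only [map_sub, torusHahn_expo, map_one]
    intro h
    have h' := congrArg (fun s => HahnSeries.coeff s 0) h
    have hne : (0 : V) ≠ -(rootWt Φ i : V) := by
      rw [ne_comm, neg_ne_zero]
      exact Φ.ne_zero i
    simp [HahnSeries.coeff_single_of_ne hne] at h'
  | one => simp
  | mul a b _ _ ha hb => simpa using ⟨ha, hb⟩

/-- The embedding of `ℂ[H_reg]` into Hahn series with `e^x ↦ T^{-x}`. -/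
def regHahn [LinearOrder V] [IsOrderedAddMonoid V] : RegRing Φ →ₐ[ℂ] HahnSeries V ℂ :=
  IsLocalization.liftAlgHom (M := rootDenoms Φ) (f := torusHahn Φ) (isUnit_torusHahn Φ)

lemma regHahn_algebraMap [LinearOrder V] [IsOrderedAddMonoid V] (f : TorusRing Φ) :
    regHahn Φ (algebraMap _ _ f) = torusHahn Φ f := by
  rw [regHahn, IsLocalization.liftAlgHom_apply, IsLocalization.lift_eq]
  rfl

lemma regHahn_injective [LinearOrder V] [IsOrderedAddMonoid V] :
    Function.Injective (regHahn Φ) := by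
  rw [injective_iff_map_eq_zero]
  intro r hr
  obtain ⟨⟨f, y⟩, h⟩ := IsLocalization.surj (rootDenoms Φ) r
  have h1 := congrArg (regHahn Φ) h
  rw [map_mul, hr, zero_mul, regHahn_algebraMap] at h1
  have hf : f = 0 := torusHahn_injective Φ (by rw [map_zero]; exact h1.symm)
  rw [hf, map_zero] at h
  exact ((IsLocalization.map_units (RegRing Φ) y).mul_left_eq_zero).1 h

lemma regHahn_invDenom [LinearOrder V] [IsOrderedAddMonoid V] {i : ι} (hi : 0 < Φ.root i) :
    regHahn Φ (invDenom Φ i) = geomSeries (Φ.root i) hi := by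
  have h1 := congrArg (regHahn Φ) (invDenom_mul Φ i)
  rw [map_mul, map_sub, map_one, regExpo, regHahn_algebraMap, torusHahn_expo] at h1
  have h2 := geomSeries_mul hi
  have hne : HahnSeries.single (-Φ.root i) (1 : ℂ) - 1 ≠ 0 := fun h => by
    rw [h, mul_zero] at h2
    exact zero_ne_one h2
  exact mul_right_cancel₀ hne (h1.trans h2.symm)

end Expansion

/-! ### Coefficient functionals -/

section Coefficients

variable {ι V E : Type*} [AddCommGroup V] [Module ℝ V] [AddCommGroup E] [Module ℝ E]
variable {Φ : RootPairing ι ℝ V E} [Φ.IsCrystallographic]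

/-- A family of functionals on `ℂ[H_reg]` behaving as the coefficients of `e^{-x}` in the expansion
of a function in the chamber of the base `b`. -/
structure IsExpansion (b : Φ.Base) (cf : V → RegRing Φ →ₗ[ℂ] ℂ) : Prop where
  eq_zero : ∀ r, (∀ x, cf x r = 0) → r = 0
  one_zero : cf 0 1 = 1
  one_of_ne : ∀ x, x ≠ 0 → cf x 1 = 0
  invDenom_eq : ∀ x i, b.IsPos i → ∀ [Decidable (∃ k : ℕ, 0 < k ∧ x = k • Φ.root i)],
    cf x (invDenom Φ i) = if ∃ k : ℕ, 0 < k ∧ x = k • Φ.root i then 1 else 0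
  invDenom_mul_eq : ∀ x i j, b.IsPos i → b.IsPos j → i ≠ j →
    ∀ [Decidable (∃ k l : ℕ, 0 < k ∧ 0 < l ∧ x = k • Φ.root i + l • Φ.root j)],
    cf x (invDenom Φ i * invDenom Φ j) =
      if ∃ k l : ℕ, 0 < k ∧ 0 < l ∧ x = k • Φ.root i + l • Φ.root j then 1 else 0

/-- The functionals are Hahn coefficients for an order in which positive roots are positive.
Distinct positive roots of a reduced system are independent, so `k α_i + l α_j` determines `k` and
`l`. -/
theorem exists_isExpansion [Φ.IsRootSystem] [Φ.IsReduced] (b : Φ.Base) :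
    ∃ cf, IsExpansion b cf := by
  obtain ⟨o, ho, hpos⟩ := exists_linearOrder b
  refine ⟨fun x =>
    { toFun := fun r => (regHahn Φ r).coeff x
      map_add' := fun r s => by simp
      map_smul' := fun c r => by simp }, ?_, ?_, ?_, ?_, ?_⟩
  · exact fun r h => regHahn_injective Φ (HahnSeries.ext (funext fun x => by simpa using h x))
  · simp [HahnSeries.coeff_one]
  · intro x hx
    simp [HahnSeries.coeff_one, hx]
  · intro x i hi _
    change (regHahn Φ _).coeff x = _
    rw [regHahn_invDenom Φ (hpos i hi), coeff_geomSeries]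
    congr
  · intro x i j hi hj hij _
    change (regHahn Φ _).coeff x = _
    rw [map_mul, regHahn_invDenom Φ (hpos i hi), regHahn_invDenom Φ (hpos j hj),
      coeff_geomSeries_mul_geomSeries]
    · congr
    · intro k l k' l' h
      have h2 := LinearIndependent.pair_iff.1 (linearIndependent_of_isPos hi hj hij)
        ((k : ℝ) - k') ((l : ℝ) - l') (by
          rw [sub_smul, sub_smul, Nat.cast_smul_eq_nsmul, Nat.cast_smul_eq_nsmul,
            Nat.cast_smul_eq_nsmul, Nat.cast_smul_eq_nsmul, sub_add_sub_comm, h, sub_self])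
      exact ⟨by exact_mod_cast sub_eq_zero.1 h2.1, by exact_mod_cast sub_eq_zero.1 h2.2⟩

/-- In a reduced system no positive root is a multiple of another, so the coefficients at roots
separate the functions `1/(e^α - 1)`. -/
lemma IsExpansion.root_invDenom [Φ.IsReduced] [DecidableEq ι] {b : Φ.Base} {cf : V → RegRing Φ →ₗ[ℂ] ℂ}
    (hcf : IsExpansion b cf) {i j : ι} (hi : b.IsPos i) (hj : b.IsPos j) :
    cf (Φ.root i) (invDenom Φ j) = if j = i then 1 else 0 := by
  classical
  rw [hcf.invDenom_eq _ _ hj]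
  refine if_congr ⟨?_, ?_⟩ rfl rfl
  · rintro ⟨k, _, h⟩
    by_contra hij
    have h2 := LinearIndependent.pair_iff.1 (linearIndependent_of_isPos hj hi hij) (k : ℝ) (-1)
      (by rw [Nat.cast_smul_eq_nsmul, ← h]; simp)
    simp at h2
  · rintro rfl
    exact ⟨1, one_pos, (one_smul _ _).symm⟩

variable {A : Type*} [Ring A] [Algebra ℂ A]

/-- A functional on `ℂ[H_reg]`, applied to `A`-valued functions. -/
def extendFunctional (c : RegRing Φ →ₗ[ℂ] ℂ) : RegRing Φ ⊗[ℂ] A →ₗ[ℂ] A :=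
  (TensorProduct.lid ℂ A).toLinearMap ∘ₗ LinearMap.rTensor A c

@[simp] lemma extendFunctional_tmul (c : RegRing Φ →ₗ[ℂ] ℂ) (r : RegRing Φ) (a : A) :
    extendFunctional c (r ⊗ₜ[ℂ] a) = c r • a := by
  simp [extendFunctional]

/-- `A` is free over `ℂ`, and the functionals act coordinatewise in a basis, which reduces the claim
to scalar functions. -/
lemma IsExpansion.eq_zero_of_extendFunctional {b : Φ.Base} {cf : V → RegRing Φ →ₗ[ℂ] ℂ}
    (hcf : IsExpansion b cf) {z : RegRing Φ ⊗[ℂ] A} (hz : ∀ x, extendFunctional (cf x) z = 0) :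
    z = 0 := by
  let B := Module.Free.chooseBasis ℂ A
  let e := TensorProduct.equivFinsuppOfBasisRight (M := RegRing Φ) B
  have key : ∀ (c : RegRing Φ →ₗ[ℂ] ℂ) m z,
      B.repr (extendFunctional c z) m = c (e z m) := by
    intro c m z
    induction z using TensorProduct.induction_on with
    | zero => simp
    | tmul r a => simp [e, mul_comm]
    | add x y hx hy => simp only [map_add, Finsupp.add_apply, hx, hy]
  refine e.injective (Finsupp.ext fun m => ?_)
  rw [map_zero]
  exact hcf.eq_zero _ fun x => by rw [← key, hz, map_zero]; rfl

end Coefficients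

/-! ### The Weyl group on weights and on `𝔥` -/

section Weyl

variable {ι V E : Type*} [AddCommGroup V] [Module ℝ V] [AddCommGroup E] [Module ℝ E]
variable (Φ : RootPairing ι ℝ V E)

lemma weylWt_mul (w w' : Φ.weylGroup) (x : weightLattice Φ) :
    weylWt Φ (w * w') x = weylWt Φ w (weylWt Φ w' x) :=
  Subtype.ext (mul_smul w w' (x : V))

lemma weylWt_inv_apply (w : Φ.weylGroup) (x : weightLattice Φ) :
    weylWt Φ w⁻¹ (weylWt Φ w x) = x :=
  Subtype.ext (inv_smul_smul w (x : V))

lemma weylCartan_mul (w w' : Φ.weylGroup) (v : Cartan Φ) :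
    weylCartan Φ (w * w') v = weylCartan Φ w (weylCartan Φ w' v) := by
  refine AddMonoidHom.ext fun x => ?_
  change v (weylWt Φ (w * w')⁻¹ x) = v (weylWt Φ w'⁻¹ (weylWt Φ w⁻¹ x))
  rw [mul_inv_rev, weylWt_mul]

lemma weylCartan_one (v : Cartan Φ) : weylCartan Φ 1 v = v :=
  AddMonoidHom.ext fun x => congrArg v (Subtype.ext (by simp [weylWt]))

lemma weylCartan_weylWt (w : Φ.weylGroup) (v : Cartan Φ) (x : weightLattice Φ) :
    weylCartan Φ w v (weylWt Φ w x) = v x :=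
  congrArg v (weylWt_inv_apply Φ w x)

end Weyl

/-! ### Derivations and Weyl action on functions -/

section RegRing

variable {ι V E : Type*} [AddCommGroup V] [Module ℝ V] [AddCommGroup E] [Module ℝ E]
variable {Φ : RootPairing ι ℝ V E} [Φ.IsCrystallographic]

/-- The exponentials generate `ℂ[H_reg]` under sums, products, scalars and inverses of units. -/
lemma regRing_induction {p : RegRing Φ → Prop} (expo : ∀ x, p (regExpo Φ x))
    (add : ∀ r s, p r → p s → p (r + s)) (mul : ∀ r s, p r → p s → p (r * s))
    (smul : ∀ (c : ℂ) r, p r → p (c • r)) (inv : ∀ r s, p r → r * s = 1 → p s) (r : RegRing Φ) :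
    p r := by
  have h : ∀ f : TorusRing Φ, p (algebraMap _ _ f) := by
    intro f
    induction f using AddMonoidAlgebra.induction_on with
    | of g => exact expo g
    | add f g hf hg => rw [map_add]; exact add _ _ hf hg
    | smul c f hf => rw [Algebra.algebraMap_eq_smul_one, smul_assoc, ← Algebra.algebraMap_eq_smul_one]; exact smul _ _ hf
  obtain ⟨⟨f, y⟩, hr⟩ := IsLocalization.surj (rootDenoms Φ) r
  obtain ⟨s, hs⟩ := (IsLocalization.map_units (RegRing Φ) y).exists_right_inv
  have : r = algebraMap _ _ f * s := by rw [← hr, mul_assoc, hs, mul_one]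
  rw [this]
  exact mul _ _ (h _) (inv _ _ (h _) hs)

lemma regRing_algHom_ext {S : Type*} [CommRing S] [Algebra ℂ S] {f g : RegRing Φ →ₐ[ℂ] S}
    (h : ∀ x, f (regExpo Φ x) = g (regExpo Φ x)) : f = g := by
  refine AlgHom.ext fun r => ?_
  induction r using regRing_induction with
  | expo x => exact h x
  | add r s hr hs => rw [map_add, map_add, hr, hs]
  | mul r s hr hs => rw [map_mul, map_mul, hr, hs]
  | smul c r hr => rw [map_smul, map_smul, hr]
  | inv r s hr hrs =>
    have h1 := congrArg f hrs
    have h2 := congrArg g hrs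
    rw [map_mul, map_one] at h1 h2
    rw [hr] at h1
    calc f s = f s * (g r * g s) := by rw [h2, mul_one]
      _ = (g r * f s) * g s := by ring
      _ = g s := by rw [h1, one_mul]

/-- The twist by `φ` lets one statement serve both for commutators of vector fields (`φ = id`) and
for comparing `w ∘ ∂_v` with `∂_{wv} ∘ w` (`φ = w`). -/
lemma regRing_twistedDerivation_ext (φ : RegRing Φ →ₐ[ℂ] RegRing Φ)
    {D D' : RegRing Φ →ₗ[ℂ] RegRing Φ}
    (hD : ∀ r s, D (r * s) = D r * φ s + φ r * D s)
    (hD' : ∀ r s, D' (r * s) = D' r * φ s + φ r * D' s)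
    (h : ∀ x, D (regExpo Φ x) = D' (regExpo Φ x)) : D = D' := by
  have one : ∀ {D : RegRing Φ →ₗ[ℂ] RegRing Φ},
      (∀ r s, D (r * s) = D r * φ s + φ r * D s) → D 1 = 0 := fun hD => by
    simpa using hD 1 1
  refine LinearMap.ext fun r => ?_
  induction r using regRing_induction with
  | expo x => exact h x
  | add r s hr hs => rw [map_add, map_add, hr, hs]
  | mul r s hr hs => rw [hD, hD', hr, hs]
  | smul c r hr => rw [map_smul, map_smul, hr]
  | inv r s hr hrs =>
    have h1 := hD r s
    have h2 := hD' r s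
    rw [hrs, one hD] at h1
    rw [hrs, one hD'] at h2
    rw [hr] at h1
    have h3 : φ r * φ s = 1 := by rw [← map_mul, hrs, map_one]
    have h4 : φ r * D s = φ r * D' s := add_left_cancel (h1.symm.trans h2)
    calc D s = (φ r * D s) * φ s := by rw [mul_right_comm, h3, one_mul]
      _ = D' s := by rw [h4, mul_right_comm, h3, one_mul]

variable (Φ)

lemma vectorField_comm (u v : Cartan Φ) (r : RegRing Φ) :
    vectorField Φ u (vectorField Φ v r) = vectorField Φ v (vectorField Φ u r) := by
  have h : (⁅vectorField Φ u, vectorField Φ v⁆ : Derivation ℂ _ _).toLinearMap = 0 := by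
    refine regRing_twistedDerivation_ext (AlgHom.id ℂ _) (fun r s => ?_) (fun r s => by simp)
      fun x => ?_
    · simp only [Derivation.coeFn_coe, Derivation.leibniz, smul_eq_mul, AlgHom.id_apply]
      ring
    · rw [Derivation.coeFn_coe, Derivation.commutator_apply]
      simp [vectorField_regExpo, smul_comm (u x)]
  have h' := LinearMap.congr_fun h r
  rw [Derivation.coeFn_coe, Derivation.commutator_apply] at h'
  exact sub_eq_zero.1 h'

lemma invDenom_unique {i : ι} {r : RegRing Φ} (h : r * (regExpo Φ (rootWt Φ i) - 1) = 1) :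
    r = invDenom Φ i :=
  (isUnit_regExpo_sub_one Φ i).mul_right_cancel (h.trans (invDenom_mul Φ i).symm)

lemma invDenom_neg {i j : ι} (h : Φ.root j = -Φ.root i) : invDenom Φ j = -1 - invDenom Φ i := by
  symm
  apply invDenom_unique
  have h1 : regExpo Φ (rootWt Φ i) * regExpo Φ (rootWt Φ j) = 1 := by
    rw [← regExpo_add, ← regExpo_zero Φ]
    exact congrArg _ (Subtype.ext (by simp [rootWt, h]))
  linear_combination (regExpo Φ (rootWt Φ j)) * invDenom_mul Φ i - invDenom Φ i * h1

lemma weylFun_invDenom (w : Φ.weylGroup) (i : ι) :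
    weylFun Φ w (invDenom Φ i) = invDenom Φ (Φ.weylGroupToPerm w i) := by
  apply invDenom_unique
  rw [← weylWt_rootWt, ← weylFun_regExpo, ← map_one (weylFun Φ w), ← map_sub, ← map_mul,
    invDenom_mul]

lemma weylCartan_rootWt (w : Φ.weylGroup) (v : Cartan Φ) (i : ι) :
    weylCartan Φ w v (rootWt Φ (Φ.weylGroupToPerm w i)) = v (rootWt Φ i) := by
  rw [← weylWt_rootWt, weylCartan_weylWt]

lemma weylFun_mul (w w' : Φ.weylGroup) (r : RegRing Φ) :
    weylFun Φ (w * w') r = weylFun Φ w (weylFun Φ w' r) := by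
  have h : weylFun Φ (w * w') = (weylFun Φ w).comp (weylFun Φ w') :=
    regRing_algHom_ext fun x => by simp [weylFun_regExpo, weylWt_mul]
  rw [h]; rfl

lemma weylFun_vectorField (w : Φ.weylGroup) (v : Cartan Φ) (r : RegRing Φ) :
    weylFun Φ w (vectorField Φ v r) = vectorField Φ (weylCartan Φ w v) (weylFun Φ w r) := by
  refine LinearMap.congr_fun (f := (weylFun Φ w).toLinearMap ∘ₗ (vectorField Φ v).toLinearMap)
    (g := (vectorField Φ (weylCartan Φ w v)).toLinearMap ∘ₗ (weylFun Φ w).toLinearMap)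
    (regRing_twistedDerivation_ext (weylFun Φ w) (fun r s => ?_) (fun r s => ?_) fun x => ?_) r
  · simp [mul_comm, add_comm]
  · simp [mul_comm, add_comm]
  · simp [vectorField_regExpo, weylFun_regExpo, weylCartan_weylWt]

lemma vectorField_invDenom (v : Cartan Φ) (i : ι) : vectorField Φ v (invDenom Φ i) =
    -(v (rootWt Φ i) • (regExpo Φ (rootWt Φ i) * invDenom Φ i ^ 2)) := by
  have h := congrArg (vectorField Φ v) (invDenom_mul Φ i)
  rw [Derivation.leibniz, map_sub, Derivation.map_one_eq_zero, sub_zero, vectorField_regExpo,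
    smul_eq_mul, smul_eq_mul] at h
  have h1 := invDenom_mul Φ i
  rw [Algebra.smul_def] at h ⊢
  linear_combination (invDenom Φ i) * h - vectorField Φ v (invDenom Φ i) * h1

end RegRing

/-! ### Flatness and equivariance in terms of the connection form -/

section Sections

variable {ι V E : Type*} [AddCommGroup V] [Module ℝ V] [AddCommGroup E] [Module ℝ E]
variable (Φ : RootPairing ι ℝ V E) [Φ.IsCrystallographic]
variable {A : Type*} [Ring A] [Algebra ℂ A]

lemma rTensor_derivation_mul (D : Derivation ℂ (RegRing Φ) (RegRing Φ)) (x y : RegRing Φ ⊗[ℂ] A) :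
    LinearMap.rTensor A D.toLinearMap (x * y) =
      LinearMap.rTensor A D.toLinearMap x * y + x * LinearMap.rTensor A D.toLinearMap y := by
  induction x using TensorProduct.induction_on with
  | zero => simp
  | add x x' hx hx' => rw [add_mul, map_add, hx, hx', map_add, add_mul, add_mul]; abel
  | tmul r a =>
    induction y using TensorProduct.induction_on with
    | zero => simp
    | add y y' hy hy' => rw [mul_add, map_add, hy, hy', map_add, mul_add, mul_add]; abel
    | tmul s c =>
      simp only [Algebra.TensorProduct.tmul_mul_tmul, LinearMap.rTensor_tmul, Derivation.coeFn_coe,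
        Derivation.leibniz, smul_eq_mul, TensorProduct.add_tmul]
      rw [add_comm, mul_comm s]

lemma rTensor_vectorField_comm (u v : Cartan Φ) (x : RegRing Φ ⊗[ℂ] A) :
    LinearMap.rTensor A (vectorField Φ u).toLinearMap
        (LinearMap.rTensor A (vectorField Φ v).toLinearMap x) =
      LinearMap.rTensor A (vectorField Φ v).toLinearMap
        (LinearMap.rTensor A (vectorField Φ u).toLinearMap x) := by
  induction x using TensorProduct.induction_on with
  | zero => simp
  | add x y hx hy => simp only [map_add, hx, hy]
  | tmul r a => simp [vectorField_comm Φ u v]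

variable (ρ : Φ.weylGroup →* (A ≃ₐ[ℂ] A))

/-- `weylSection` as an algebra homomorphism. -/
def weylSectionAlgHom (w : Φ.weylGroup) : RegRing Φ ⊗[ℂ] A →ₐ[ℂ] RegRing Φ ⊗[ℂ] A :=
  Algebra.TensorProduct.map (weylFun Φ w) (ρ w).toAlgHom

lemma weylSection_tmul (w : Φ.weylGroup) (r : RegRing Φ) (a : A) :
    weylSection Φ ρ w (r ⊗ₜ a) = weylFun Φ w r ⊗ₜ ρ w a := rfl

lemma weylSection_eq (w : Φ.weylGroup) (s : RegRing Φ ⊗[ℂ] A) :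
    weylSection Φ ρ w s = weylSectionAlgHom Φ ρ w s := rfl

lemma weylSection_rTensor (w : Φ.weylGroup) (v : Cartan Φ) (s : RegRing Φ ⊗[ℂ] A) :
    weylSection Φ ρ w (LinearMap.rTensor A (vectorField Φ v).toLinearMap s) =
      LinearMap.rTensor A (vectorField Φ (weylCartan Φ w v)).toLinearMap
        (weylSection Φ ρ w s) := by
  induction s using TensorProduct.induction_on with
  | zero => simp
  | add x y hx hy => simp only [map_add, hx, hy]
  | tmul r a => simp [weylSection_tmul, weylFun_vectorField]

lemma weylSection_mul (w w' : Φ.weylGroup) (s : RegRing Φ ⊗[ℂ] A) :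
    weylSection Φ ρ (w * w') s = weylSection Φ ρ w (weylSection Φ ρ w' s) := by
  induction s using TensorProduct.induction_on with
  | zero => simp
  | add x y hx hy => simp only [map_add, hx, hy]
  | tmul r a => simp [weylSection_tmul, weylFun_mul]

variable [Fintype ι] (b : Φ.Base) (t : ι → A) (τ : Cartan Φ →ₗ[ℂ] A)

/-- This is closedness of the form: `∂_u` of the `α` term at `v` is a multiple of `α(u) α(v)`,
symmetric in `u` and `v`. -/
lemma rTensor_vectorField_connForm (u v : Cartan Φ) :
    LinearMap.rTensor A (vectorField Φ u).toLinearMap (connForm Φ b t τ v) =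
      LinearMap.rTensor A (vectorField Φ v).toLinearMap (connForm Φ b t τ u) := by
  simp only [connForm, map_add, map_sum, LinearMap.rTensor_tmul, Derivation.coeFn_coe,
    Derivation.map_smul, Derivation.map_one_eq_zero, TensorProduct.zero_tmul, add_zero,
    vectorField_invDenom, smul_neg]
  exact Finset.sum_congr rfl fun i _ => by rw [smul_comm]

/-- As the form is closed, the derivative terms cancel and the curvature is left multiplication by
the commutator; applying it to the section `1` recovers the commutator. -/
theorem isFlat_trigConn_iff : IsFlat Φ (trigConn Φ b t τ) ↔
    ∀ u v, ⁅connForm Φ b t τ u, connForm Φ b t τ v⁆ = 0 := by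
  refine forall₂_congr fun u v => ?_
  have h : ⁅trigConn Φ b t τ u, trigConn Φ b t τ v⁆ =
      LinearMap.mulLeft ℂ ⁅connForm Φ b t τ u, connForm Φ b t τ v⁆ := by
    refine LinearMap.ext fun s => ?_
    simp only [Ring.lie_def, trigConn, LinearMap.sub_apply, Module.End.mul_apply,
      LinearMap.mulLeft_apply, rTensor_derivation_mul, rTensor_vectorField_comm Φ u v,
      rTensor_vectorField_connForm Φ b t τ u v, sub_mul, mul_sub, mul_assoc]
    abel
  rw [h]
  refine ⟨fun h => ?_, fun h => by rw [h]; ext; simp⟩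
  simpa using LinearMap.congr_fun h 1

theorem isWeylEquivariant_trigConn_iff_forall : IsWeylEquivariant Φ ρ (trigConn Φ b t τ) ↔
    ∀ w v, weylSection Φ ρ w (connForm Φ b t τ v) = connForm Φ b t τ (weylCartan Φ w v) := by
  refine forall₂_congr fun w v => ?_
  have h : ∀ s, weylSection Φ ρ w (trigConn Φ b t τ v s) =
      trigConn Φ b t τ (weylCartan Φ w v) (weylSection Φ ρ w s) ↔
      weylSection Φ ρ w (connForm Φ b t τ v) * weylSection Φ ρ w s =
      connForm Φ b t τ (weylCartan Φ w v) * weylSection Φ ρ w s := by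
    intro s
    simp only [trigConn, LinearMap.sub_apply, map_sub, weylSection_rTensor, sub_right_inj,
      LinearMap.mulLeft_apply]
    rw [weylSection_eq _ _ _ (_ * _), map_mul]
    rfl
  simp only [h]
  refine ⟨fun h => ?_, fun h s => by rw [h]⟩
  have h1 := h 1
  rwa [weylSection_eq _ _ _ 1, map_one, mul_one, mul_one] at h1

end Sections

/-! ### Negation of roots and generation by simple reflections -/

section Roots

variable {ι V E : Type*} [AddCommGroup V] [Module ℝ V] [AddCommGroup E] [Module ℝ E]
variable {Φ : RootPairing ι ℝ V E} (b : Φ.Base)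

lemma isPos_neg_iff (i : ι) : b.IsPos (Φ.reflectionPerm i i) ↔ ¬ b.IsPos i :=
  RootPairing.Base.IsPos.neg_iff_not b i

lemma root_neg (i : ι) : Φ.root (Φ.reflectionPerm i i) = -Φ.root i := by simp

lemma neg_neg_idx (i : ι) :
    Φ.reflectionPerm (Φ.reflectionPerm i i) (Φ.reflectionPerm i i) = i :=
  letI := Φ.indexNeg
  neg_neg i

/-- The element of `𝔥` with real values given by a linear functional. -/
def realCartan (f : V →ₗ[ℝ] ℝ) : Cartan Φ :=
  (Complex.ofRealHom : ℝ →+ ℂ).comp (f.toAddMonoidHom.comp (weightLattice Φ).subtype)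

lemma realCartan_rootWt [Φ.IsCrystallographic] (f : V →ₗ[ℝ] ℝ) (i : ι) :
    realCartan f (rootWt Φ i) = (f (Φ.root i) : ℂ) := rfl

lemma exists_cartan_ne_zero [Φ.IsCrystallographic] (i : ι) :
    ∃ v : Cartan Φ, v (rootWt Φ i) ≠ 0 :=
  ⟨realCartan (Φ.toLinearMap.flip (Φ.coroot i)), by simp [realCartan_rootWt]⟩

lemma weylGroupToPerm_ofIdx (i j : ι) :
    Φ.weylGroupToPerm (RootPairing.weylGroup.ofIdx Φ i) j = Φ.reflectionPerm i j := rfl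

section

variable [Φ.IsCrystallographic]

lemma weylCartan_ofIdx_rootWt (i j : ι) (v : Cartan Φ) :
    weylCartan Φ (RootPairing.weylGroup.ofIdx Φ i) v (rootWt Φ (Φ.reflectionPerm i j)) =
      v (rootWt Φ j) :=
  weylCartan_rootWt Φ (RootPairing.weylGroup.ofIdx Φ i) v j

lemma cartan_rootWt_neg {i j : ι} (h : Φ.root j = -Φ.root i) (v : Cartan Φ) :
    v (rootWt Φ j) = -v (rootWt Φ i) := by
  rw [← map_neg]
  exact congrArg v (Subtype.ext h)

lemma weylCartan_ofIdx_rootWt_self (i : ι) (v : Cartan Φ) :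
    weylCartan Φ (RootPairing.weylGroup.ofIdx Φ i) v (rootWt Φ i) = -v (rootWt Φ i) := by
  have h := weylCartan_ofIdx_rootWt i i v
  rw [cartan_rootWt_neg (root_neg i)] at h
  rw [← h, neg_neg]

end

variable [Finite ι] [Φ.IsCrystallographic] [Φ.IsReduced]

/-- Every root is reached from simple ones by negation and simple reflections; correspondingly
`s_{-α} = s_α` and `s_{s_j α} = s_j s_α s_j`, so simple reflections generate `W`. -/
lemma weyl_induction_simple {p : Φ.weylGroup → Prop}
    (simple : ∀ i ∈ b.support, p (RootPairing.weylGroup.ofIdx Φ i)) (one : p 1)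
    (mul : ∀ w w', p w → p w' → p (w * w')) (w : Φ.weylGroup) : p w := by
  have key : ∀ i, p (RootPairing.weylGroup.ofIdx Φ i) := by
    intro i
    refine b.induction_reflect i (p := fun i => p (RootPairing.weylGroup.ofIdx Φ i)) ?_ simple ?_
    · intro i hi
      convert hi using 1
      refine Subtype.ext (RootPairing.Equiv.weightHom_injective Φ (LinearEquiv.ext fun x => ?_))
      change Φ.reflection _ x = Φ.reflection _ x
      simp [RootPairing.reflection_apply]
      module
    · intro i j hi hj
      convert mul _ _ (mul _ _ (simple j hj) hi) (simple j hj) using 1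
      refine Subtype.ext (RootPairing.Equiv.weightHom_injective Φ (LinearEquiv.ext fun x => ?_))
      change Φ.reflection _ x = Φ.reflection j (Φ.reflection i (Φ.reflection j x))
      rw [RootPairing.reflection_reflectionPerm]
      rfl
  obtain ⟨w, hw⟩ := w
  induction hw using RootPairing.weylGroup.induction with
  | mem i => exact key i
  | one => exact one
  | mul x y hx hy hx' hy' => exact mul ⟨x, hx⟩ ⟨y, hy⟩ hx' hy'

end Roots

/-! ### Sums over positive roots -/

section PosRoots

variable {ι V E : Type*} [AddCommGroup V] [Module ℝ V] [AddCommGroup E] [Module ℝ E]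
variable {Φ : RootPairing ι ℝ V E} [Fintype ι] (b : Φ.Base)

lemma mem_posRoots {i : ι} : i ∈ posRoots b ↔ b.IsPos i := by
  simp [posRoots]

lemma sum_eq_sum_posRoots {M : Type*} [AddCommMonoid M] (g : ι → M) :
    ∑ j, g j = ∑ j ∈ posRoots b, (g j + g (Φ.reflectionPerm j j)) := by
  classical
  rw [Finset.sum_add_distrib, ← Finset.sum_add_sum_compl (posRoots b) g]
  congr 1
  refine Finset.sum_nbij' (fun j => Φ.reflectionPerm j j) (fun j => Φ.reflectionPerm j j)
    ?_ ?_ ?_ ?_ ?_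
  · intro j hj
    rw [mem_posRoots, isPos_neg_iff, ← mem_posRoots]
    exact Finset.mem_compl.1 hj
  · intro j hj
    rw [Finset.mem_compl, mem_posRoots, isPos_neg_iff, not_not, ← mem_posRoots]
    exact hj
  · exact fun j _ => neg_neg_idx j
  · exact fun j _ => neg_neg_idx j
  · exact fun j _ => by rw [neg_neg_idx]

lemma sum_posRoots_eq_add_erase [DecidableEq ι] {M : Type*} [AddCommMonoid M] {i : ι}
    (hi : i ∈ b.support) (g : ι → M) :
    ∑ j ∈ posRoots b, g j = g i + ∑ j ∈ (posRoots b).erase i, g j :=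
  (Finset.add_sum_erase _ _
    ((mem_posRoots b).2 (RootPairing.Base.isPos_of_mem_support hi))).symm

variable [Φ.IsCrystallographic] [Φ.IsReduced]

lemma reflectionPerm_mem_posRoots_erase [DecidableEq ι] {i j : ι} (hi : i ∈ b.support)
    (hj : j ∈ (posRoots b).erase i) : Φ.reflectionPerm i j ∈ (posRoots b).erase i := by
  rw [Finset.mem_erase, mem_posRoots] at hj ⊢
  refine ⟨fun h => ?_, hj.2.reflectionPerm hi hj.1⟩
  have h1 : j = Φ.reflectionPerm i i := by
    conv_lhs => rw [← Φ.reflectionPerm_self i j, h]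
  rw [h1, isPos_neg_iff] at hj
  exact hj.2 (RootPairing.Base.isPos_of_mem_support hi)

lemma sum_posRoots_reflectionPerm [DecidableEq ι] {M : Type*} [AddCommMonoid M] {i : ι}
    (hi : i ∈ b.support) (g : ι → M) :
    ∑ j ∈ (posRoots b).erase i, g (Φ.reflectionPerm i j) = ∑ j ∈ (posRoots b).erase i, g j :=
  Finset.sum_nbij' (Φ.reflectionPerm i) (Φ.reflectionPerm i)
    (fun _ => reflectionPerm_mem_posRoots_erase b hi)
    (fun _ => reflectionPerm_mem_posRoots_erase b hi)
    (fun _ _ => Φ.reflectionPerm_self i _) (fun _ _ => Φ.reflectionPerm_self i _) (fun _ _ => rfl)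

/-! ### Equivariance of the connection and of `δ` -/

section Equivariance

variable {A : Type*} [Ring A] [Algebra ℂ A] (ρ : Φ.weylGroup →* (A ≃ₐ[ℂ] A)) {t : ι → A}
  (τ : Cartan Φ →ₗ[ℂ] A)

-- All terms are written so that the functions `1/(e^β - 1)`, `β > 0`, and `1` appear once each. The
-- extra constant `-α_i(v) s_i(t_{α_i})` comes from `s_i (1/(e^{α_i} - 1)) = -1 - 1/(e^{α_i} - 1)`.
variable (t) in
lemma weylSection_connForm_sub [DecidableEq ι] {i : ι} (hi : i ∈ b.support) (v : Cartan Φ) :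
    weylSection Φ ρ (RootPairing.weylGroup.ofIdx Φ i) (connForm Φ b t τ v) -
      connForm Φ b t τ (weylCartan Φ (RootPairing.weylGroup.ofIdx Φ i) v) =
    ∑ j ∈ (posRoots b).erase i, (v (rootWt Φ j) • invDenom Φ (Φ.reflectionPerm i j)) ⊗ₜ[ℂ]
        (ρ (RootPairing.weylGroup.ofIdx Φ i) (t j) - t (Φ.reflectionPerm i j)) -
      (v (rootWt Φ i) • invDenom Φ i) ⊗ₜ[ℂ] (ρ (RootPairing.weylGroup.ofIdx Φ i) (t i) - t i) +
      1 ⊗ₜ[ℂ] (ρ (RootPairing.weylGroup.ofIdx Φ i) (τ v) -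
        τ (weylCartan Φ (RootPairing.weylGroup.ofIdx Φ i) v) -
        v (rootWt Φ i) • ρ (RootPairing.weylGroup.ofIdx Φ i) (t i)) := by
  set s := RootPairing.weylGroup.ofIdx Φ i with hs
  have h1 : weylSection Φ ρ s (connForm Φ b t τ v) =
      -((v (rootWt Φ i) • 1) ⊗ₜ[ℂ] ρ s (t i)) - (v (rootWt Φ i) • invDenom Φ i) ⊗ₜ[ℂ] ρ s (t i) +
      ∑ j ∈ (posRoots b).erase i,
        (v (rootWt Φ j) • invDenom Φ (Φ.reflectionPerm i j)) ⊗ₜ[ℂ] ρ s (t j) + 1 ⊗ₜ ρ s (τ v) := by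
    rw [connForm, map_add, map_sum, sum_posRoots_eq_add_erase b hi]
    simp only [weylSection_tmul, map_smul, weylFun_invDenom, hs, weylGroupToPerm_ofIdx, map_one]
    rw [invDenom_neg Φ (root_neg i), smul_sub, TensorProduct.sub_tmul, smul_neg,
      TensorProduct.neg_tmul]
  have h2 : connForm Φ b t τ (weylCartan Φ s v) =
      -((v (rootWt Φ i) • invDenom Φ i) ⊗ₜ[ℂ] t i) +
      ∑ j ∈ (posRoots b).erase i,
        (v (rootWt Φ j) • invDenom Φ (Φ.reflectionPerm i j)) ⊗ₜ[ℂ] t (Φ.reflectionPerm i j) +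
      1 ⊗ₜ τ (weylCartan Φ s v) := by
    rw [connForm, sum_posRoots_eq_add_erase b hi, ← sum_posRoots_reflectionPerm b hi]
    simp only [hs, weylCartan_ofIdx_rootWt, weylCartan_ofIdx_rootWt_self, neg_smul,
      TensorProduct.neg_tmul]
  rw [h1, h2]
  simp only [TensorProduct.tmul_sub, Finset.sum_sub_distrib, TensorProduct.tmul_smul,
    TensorProduct.smul_tmul']
  abel

lemma reg_simple_iff [Φ.IsRootSystem] (ht : ∀ i j, Φ.root j = -Φ.root i → t j = t i) {i : ι}
    (hi : i ∈ b.support) :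
    (∀ v, weylSection Φ ρ (RootPairing.weylGroup.ofIdx Φ i) (connForm Φ b t τ v) =
      connForm Φ b t τ (weylCartan Φ (RootPairing.weylGroup.ofIdx Φ i) v)) ↔
    (∀ j, ρ (RootPairing.weylGroup.ofIdx Φ i) (t j) = t (Φ.reflectionPerm i j)) ∧
    ∀ u : Cartan Φ, ρ (RootPairing.weylGroup.ofIdx Φ i) (τ u) -
      τ (weylCartan Φ (RootPairing.weylGroup.ofIdx Φ i) u) = u (rootWt Φ i) • t i := by
  classical
  have hip := RootPairing.Base.isPos_of_mem_support hi
  have hti : t (Φ.reflectionPerm i i) = t i := ht _ _ (root_neg i)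
  simp only [← sub_eq_zero (b := connForm Φ b t τ _), weylSection_connForm_sub b ρ t τ hi]
  set s := RootPairing.weylGroup.ofIdx Φ i
  constructor
  · intro h
    obtain ⟨cf, hcf⟩ := exists_isExpansion b
    have hx : ∀ x v, _ = extendFunctional (A := A) (cf x) 0 :=
      fun x v => congrArg (extendFunctional (cf x)) (h v)
    simp only [map_add, map_sub, map_sum, extendFunctional_tmul, map_smul, map_zero] at hx
    -- The coefficient at `x = α_i` isolates the `α_i` term.
    have hsi : ρ s (t i) = t i := by
      obtain ⟨v, hv⟩ := exists_cartan_ne_zero (Φ := Φ) i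
      have h1 := hx (Φ.root i) v
      rw [hcf.root_invDenom hip hip, hcf.one_of_ne _ (Φ.ne_zero i), Finset.sum_eq_zero] at h1
      · simpa [hv, sub_eq_zero] using h1
      · intro j hj
        have hj' := reflectionPerm_mem_posRoots_erase b hi hj
        rw [Finset.mem_erase, mem_posRoots] at hj'
        rw [hcf.root_invDenom hip hj'.2, if_neg hj'.1]
        simp
    have hpos : ∀ j ∈ (posRoots b).erase i, ρ s (t j) = t (Φ.reflectionPerm i j) := by
      intro j hj
      obtain ⟨v, hv⟩ := exists_cartan_ne_zero (Φ := Φ) j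
      have hj' := reflectionPerm_mem_posRoots_erase b hi hj
      rw [Finset.mem_erase, mem_posRoots] at hj'
      -- The coefficient at `x = s_i α_j` isolates the term of index `j`.
      have h1 := hx (Φ.root (Φ.reflectionPerm i j)) v
      rw [hsi, sub_self, smul_zero, hcf.one_of_ne _ (Φ.ne_zero _), zero_smul, sub_zero, add_zero,
        Finset.sum_eq_single_of_mem j hj, hcf.root_invDenom hj'.2 hj'.2] at h1
      · simpa [hv, sub_eq_zero] using h1
      · intro k hk hkj
        have hk' := reflectionPerm_mem_posRoots_erase b hi hk
        rw [Finset.mem_erase, mem_posRoots] at hk'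
        rw [hcf.root_invDenom hj'.2 hk'.2, if_neg fun h => hkj ((Φ.reflectionPerm i).injective h)]
        simp
    have hpos' : ∀ j, b.IsPos j → ρ s (t j) = t (Φ.reflectionPerm i j) := by
      intro j hj
      by_cases hji : j = i
      · rw [hji, hsi, hti]
      · exact hpos j (Finset.mem_erase.2 ⟨hji, (mem_posRoots b).2 hj⟩)
    refine ⟨fun j => ?_, fun v => ?_⟩
    · by_cases hj : b.IsPos j
      · exact hpos' j hj
      · have h1 := hpos' _ ((isPos_neg_iff b j).2 hj)
        rw [ht _ _ (root_neg j)] at h1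
        rw [h1]
        refine ht _ _ ?_
        rw [RootPairing.root_reflectionPerm, root_neg, map_neg, RootPairing.root_reflectionPerm]
    -- The other terms already vanish, and the constant coefficient is the twisted relation for `τ`.
    · have h1 := hx 0 v
      rw [hsi, sub_self, smul_zero, sub_zero, hcf.one_zero, one_smul, Finset.sum_eq_zero,
        zero_add] at h1
      · exact sub_eq_zero.1 h1
      · intro j hj
        rw [hpos j hj, sub_self, smul_zero]
  · rintro ⟨h1, h2⟩ v
    rw [h2, h1 i, hti, sub_self, sub_self, TensorProduct.tmul_zero, TensorProduct.tmul_zero,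
      Finset.sum_eq_zero]
    · simp
    · intro j _
      rw [h1, sub_self, TensorProduct.tmul_zero]

theorem isWeylEquivariant_trigConn_iff [Φ.IsRootSystem]
    (ht : ∀ i j, Φ.root j = -Φ.root i → t j = t i) :
    IsWeylEquivariant Φ ρ (trigConn Φ b t τ) ↔
      TEquivariant Φ b ρ t ∧ TauTwisted Φ b ρ t τ := by
  rw [isWeylEquivariant_trigConn_iff_forall]
  have h : (∀ w v, weylSection Φ ρ w (connForm Φ b t τ v) =
      connForm Φ b t τ (weylCartan Φ w v)) ↔ ∀ i ∈ b.support, ∀ v,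
      weylSection Φ ρ (RootPairing.weylGroup.ofIdx Φ i) (connForm Φ b t τ v) =
      connForm Φ b t τ (weylCartan Φ (RootPairing.weylGroup.ofIdx Φ i) v) := by
    refine ⟨fun h i _ => h _, fun h w => ?_⟩
    induction w using weyl_induction_simple b with
    | simple i hi => exact h i hi
    | one =>
      intro v
      have h2 : weylFun Φ 1 = AlgHom.id ℂ _ := regRing_algHom_ext fun x => by
        rw [weylFun_regExpo]
        exact congrArg _ (Subtype.ext (one_smul _ (x : V)))
      have h3 : ∀ s : RegRing Φ ⊗[ℂ] A, weylSection Φ ρ 1 s = s := fun s => by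
        induction s using TensorProduct.induction_on with
        | zero => simp
        | add x y hx hy => rw [map_add, hx, hy]
        | tmul r a => rw [weylSection_tmul, h2, map_one]; rfl
      rw [weylCartan_one, h3]
    | mul w w' hw hw' =>
      intro v
      rw [weylSection_mul, hw', hw, weylCartan_mul]
  rw [h]
  refine ⟨fun h => ⟨fun i hi => ((reg_simple_iff b ρ τ ht hi).1 (h i hi)).1,
    fun i hi => ((reg_simple_iff b ρ τ ht hi).1 (h i hi)).2⟩,
    fun h i hi => (reg_simple_iff b ρ τ ht hi).2 ⟨h.1 i hi, h.2 i hi⟩⟩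

theorem tauTwisted_iff_delta (ht : ∀ i j, Φ.root j = -Φ.root i → t j = t i)
    (hd : TEquivariant Φ b ρ t) :
    TauTwisted Φ b ρ t τ ↔ ∀ (w : Φ.weylGroup) (v : Cartan Φ),
      ρ w (delta Φ b t τ v) = delta Φ b t τ (weylCartan Φ w v) := by
  classical
  -- Only the `α_i` term of the half sum changes sign under `s_i`; the two halves add up to `α_i(v)
  -- t_{α_i}`.
  have key : ∀ i ∈ b.support, ∀ v : Cartan Φ,
      ρ (RootPairing.weylGroup.ofIdx Φ i) (delta Φ b t τ v) -
        delta Φ b t τ (weylCartan Φ (RootPairing.weylGroup.ofIdx Φ i) v) =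
      ρ (RootPairing.weylGroup.ofIdx Φ i) (τ v) -
        τ (weylCartan Φ (RootPairing.weylGroup.ofIdx Φ i) v) - v (rootWt Φ i) • t i := by
    intro i hi v
    have hti : t (Φ.reflectionPerm i i) = t i := ht _ _ (root_neg i)
    rw [delta, delta, sum_posRoots_eq_add_erase b hi, sum_posRoots_eq_add_erase b hi,
      ← sum_posRoots_reflectionPerm b hi fun j =>
        weylCartan Φ (RootPairing.weylGroup.ofIdx Φ i) v (rootWt Φ j) • t j]
    simp only [weylCartan_ofIdx_rootWt, weylCartan_ofIdx_rootWt_self, map_sub, map_smul, map_add,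
      map_sum, hd i hi, hti]
    module
  constructor
  · intro he w
    induction w using weyl_induction_simple b with
    | simple i hi =>
      intro v
      rw [← sub_eq_zero, key i hi, he i hi, sub_self]
    | one =>
      intro v
      rw [weylCartan_one, map_one]; rfl
    | mul w w' hw hw' =>
      intro v
      rw [map_mul, AlgEquiv.mul_apply, hw', hw, weylCartan_mul]
  · intro h i hi v
    rw [← sub_eq_zero, ← key i hi, h, sub_self]

end Equivariance

end PosRoots

/-! ### Commutator identities -/

section Lie

variable {A : Type*} [Ring A]

lemma ring_lie_self (a : A) : ⁅a, a⁆ = 0 := by rw [Ring.lie_def, sub_self]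

lemma ring_lie_comm (a c : A) : ⁅a, c⁆ = -⁅c, a⁆ := by
  rw [Ring.lie_def, Ring.lie_def, neg_sub]

lemma ring_lie_sum {κ : Type*} (a : A) (s : Finset κ) (f : κ → A) :
    ⁅a, ∑ j ∈ s, f j⁆ = ∑ j ∈ s, ⁅a, f j⁆ := by
  simp only [Ring.lie_def, Finset.mul_sum, Finset.sum_mul, Finset.sum_sub_distrib]

lemma ring_lie_smul [Algebra ℂ A] (a : A) (c : ℂ) (x : A) : ⁅a, c • x⁆ = c • ⁅a, x⁆ := by
  simp only [Ring.lie_def, mul_smul_comm, smul_mul_assoc, smul_sub]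

end Lie

/-! ### Root strings and the string relations -/

section Strings

variable {ι V E : Type*} [AddCommGroup V] [Module ℝ V] [AddCommGroup E] [Module ℝ E]

/-- `α_j` and `α_k` are congruent modulo `ℤ α_i`. -/
def SameString (Φ : RootPairing ι ℝ V E) (i j k : ι) : Prop :=
  ∃ n : ℤ, Φ.root k = Φ.root j + n • Φ.root i

variable {Φ : RootPairing ι ℝ V E}

lemma sameString_equivalence (i : ι) : Equivalence (SameString Φ i) where
  refl j := ⟨0, by simp⟩
  symm := fun ⟨n, h⟩ => ⟨-n, by rw [h]; module⟩
  trans := fun ⟨n, h⟩ ⟨m, h'⟩ => ⟨n + m, by rw [h', h]; module⟩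

lemma sameString_neg_iff {i j k : ι} :
    SameString Φ i (Φ.reflectionPerm j j) (Φ.reflectionPerm k k) ↔ SameString Φ i j k := by
  rw [SameString, SameString, root_neg, root_neg]
  constructor
  · rintro ⟨n, h⟩
    exact ⟨-n, by rw [← neg_neg (Φ.root k), h]; module⟩
  · rintro ⟨n, h⟩
    exact ⟨-n, by rw [h]; module⟩

variable {A : Type*} [Ring A]

variable (Φ) in
open Classical in
/-- The sum of `[t_{α_i}, t_β]` over the roots `β` congruent to `α_j` modulo `ℤ α_i`. -/
def stringSum [Fintype ι] (t : ι → A) (i j : ι) : A :=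
  ∑ k ∈ Finset.univ.filter (SameString Φ i j), ⁅t i, t k⁆

variable {t : ι → A}

lemma lie_eq_zero_of_root_eq_smul [Φ.IsReduced]
    (ht : ∀ i j, Φ.root j = -Φ.root i → t j = t i) {i j : ι} {c : ℝ} (h : Φ.root j = c • Φ.root i) :
    ⁅t i, t j⁆ = 0 := by
  have hn : ¬ LinearIndependent ℝ ![Φ.root i, Φ.root j] := fun hl => by
    have := LinearIndependent.pair_iff.1 hl c (-1) (by rw [h]; module)
    simp at this
  rcases RootPairing.IsReduced.eq_or_eq_neg i j hn with h1 | h1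
  · rw [Φ.root.injective h1, ring_lie_self]
  · rw [ht j i h1, ring_lie_self]

variable [Fintype ι]

lemma stringSum_neg
    (ht : ∀ i j, Φ.root j = -Φ.root i → t j = t i) (i j : ι) : stringSum Φ t i (Φ.reflectionPerm j j) = stringSum Φ t i j := by
  classical
  refine Finset.sum_nbij' (fun k => Φ.reflectionPerm k k) (fun k => Φ.reflectionPerm k k)
    ?_ ?_ (fun k _ => neg_neg_idx k) (fun k _ => neg_neg_idx k) (fun k _ => ?_)
  · intro k hk
    rw [Finset.mem_filter] at hk ⊢
    refine ⟨Finset.mem_univ _, ?_⟩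
    rw [← sameString_neg_iff, neg_neg_idx]
    exact hk.2
  · intro k hk
    rw [Finset.mem_filter] at hk ⊢
    exact ⟨Finset.mem_univ _, sameString_neg_iff.2 hk.2⟩
  · rw [ht _ _ (root_neg k)]

lemma stringSum_self [Φ.IsReduced]
    (ht : ∀ i j, Φ.root j = -Φ.root i → t j = t i) (i : ι) : stringSum Φ t i i = 0 := by
  classical
  refine Finset.sum_eq_zero fun k hk => ?_
  obtain ⟨n, hn⟩ := (Finset.mem_filter.1 hk).2
  refine lie_eq_zero_of_root_eq_smul ht (c := 1 + n) ?_
  rw [hn, add_smul, one_smul, Int.cast_smul_eq_zsmul]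

variable [Algebra ℂ A]

variable (Φ) in
/-- The relation `∑_β φ(β) [t_{α_i}, t_β] = 0` for all functions `φ` of the class of `β` modulo
`ℤ α_i`. -/
def StringRel (t : ι → A) (i : ι) : Prop :=
  ∀ φ : ι → ℂ, (∀ j k, SameString Φ i j k → φ k = φ j) → ∑ j, φ j • ⁅t i, t j⁆ = 0

/-- Grouping the sum by classes modulo `ℤα_i` pulls out the constant value of `φ`. Requiring
`stringSum = 0` only where `φ ≠ 0` is what the inductions below need. -/
lemma sum_smul_lie_eq_zero {t : ι → A} {i : ι} {φ : ι → ℂ}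
    (hφ : ∀ j k, SameString Φ i j k → φ k = φ j) (h : ∀ j, φ j ≠ 0 → stringSum Φ t i j = 0) :
    ∑ j, φ j • ⁅t i, t j⁆ = 0 := by
  classical
  let s : Setoid ι := ⟨SameString Φ i, sameString_equivalence i⟩
  rw [← Finset.sum_fiberwise Finset.univ (fun j => (⟦j⟧ : Quotient s))]
  refine Finset.sum_eq_zero fun q _ => ?_
  induction q using Quotient.inductionOn with
  | h k =>
    have h1 : Finset.univ.filter (fun j => (⟦j⟧ : Quotient s) = ⟦k⟧) =
        Finset.univ.filter (SameString Φ i k) := by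
      refine Finset.filter_congr fun j _ => ?_
      rw [Quotient.eq]
      exact ⟨(sameString_equivalence i).symm, (sameString_equivalence i).symm⟩
    rw [h1]
    have h2 : ∀ j ∈ Finset.univ.filter (SameString Φ i k), φ j • ⁅t i, t j⁆ = φ k • ⁅t i, t j⁆ :=
      fun j hj => by rw [hφ k j (Finset.mem_filter.1 hj).2]
    rw [Finset.sum_congr rfl h2, ← Finset.smul_sum]
    by_cases hk : φ k = 0
    · rw [hk, zero_smul]
    · exact (congrArg (φ k • ·) (h k hk)).trans (smul_zero _)

lemma sum_ite_mem_lie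
    (ht : ∀ i j, Φ.root j = -Φ.root i → t j = t i) (b : Φ.Base) (i : ι) (Ψ : Set ι) [DecidablePred (· ∈ Ψ)]
    (hΨ : ∀ j ∈ Ψ, Φ.reflectionPerm j j ∈ Ψ) :
    ∑ j, (if j ∈ Ψ then 1 else 0 : ℂ) • ⁅t i, t j⁆ =
      (2 : ℂ) • ⁅t i, ∑ j ∈ (posRoots b).filter (fun j => j ∈ Ψ), t j⁆ := by
  have hiff : ∀ j, Φ.reflectionPerm j j ∈ Ψ ↔ j ∈ Ψ :=
    fun j => ⟨fun h => by simpa only [neg_neg_idx] using hΨ _ h, hΨ j⟩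
  rw [sum_eq_sum_posRoots b, ring_lie_sum, Finset.smul_sum, Finset.sum_filter]
  refine Finset.sum_congr rfl fun j _ => ?_
  simp only [ht _ _ (root_neg j), hiff]
  split_ifs <;> simp [two_smul]

lemma StringRel.neg (ht : ∀ i j, Φ.root j = -Φ.root i → t j = t i) {i : ι}
    (h : StringRel Φ t i) : StringRel Φ t (Φ.reflectionPerm i i) := by
  intro φ hφ
  rw [ht _ _ (root_neg i)]
  refine h φ fun j k ⟨n, hn⟩ => hφ j k ⟨-n, ?_⟩
  rw [hn, root_neg]
  module

/-- By (d), `s_j` carries the relation for `α_i` to the one for `s_j α_i`, as it maps classes modulo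
`ℤα_i` to classes modulo `ℤ s_j α_i`. -/
lemma stringRel_of_simple [Φ.IsCrystallographic] [Φ.IsReduced]
    (ht : ∀ i j, Φ.root j = -Φ.root i → t j = t i) {b : Φ.Base}
    {ρ : Φ.weylGroup →* (A ≃ₐ[ℂ] A)} (hd : TEquivariant Φ b ρ t)
    (h : ∀ i ∈ b.support, StringRel Φ t i) (i : ι) : StringRel Φ t i := by
  refine b.induction_reflect i (p := StringRel Φ t) (fun i hi => hi.neg ht) h fun i j hi hj => ?_
  intro φ hφ
  rw [← Equiv.sum_comp (Φ.reflectionPerm j)]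
  simp only [← hd j hj]
  have h1 := congrArg (ρ (RootPairing.weylGroup.ofIdx Φ j))
    (hi (fun k => φ (Φ.reflectionPerm j k)) fun k l ⟨n, hn⟩ => hφ _ _ ⟨n, by
      rw [RootPairing.root_reflectionPerm, RootPairing.root_reflectionPerm,
        RootPairing.root_reflectionPerm, hn, map_add, map_zsmul]⟩)
  rw [map_zero, map_sum] at h1
  rw [← h1]
  refine Finset.sum_congr rfl fun k _ => ?_
  simp only [map_smul, Ring.lie_def, map_sub, map_mul]

end Strings

/-! ### Rank 2 subsystems versus string relations -/

section Planes

variable {ι V E : Type*} [AddCommGroup V] [Module ℝ V] [AddCommGroup E] [Module ℝ E]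

/-- The roots in `ℤ α_i + ℤ α_j`. -/
def rootPlane (Φ : RootPairing ι ℝ V E) (i j : ι) : Set ι :=
  {k | ∃ m n : ℤ, Φ.root k = m • Φ.root j + n • Φ.root i}

variable {Φ : RootPairing ι ℝ V E}

lemma left_mem_rootPlane (i j : ι) : i ∈ rootPlane Φ i j := ⟨0, 1, by simp⟩

lemma right_mem_rootPlane (i j : ι) : j ∈ rootPlane Φ i j := ⟨1, 0, by simp⟩

lemma isRankTwoSubsystem_rootPlane {i j : ι} (hij : LinearIndependent ℝ ![Φ.root i, Φ.root j]) :
    IsRankTwoSubsystem Φ (rootPlane Φ i j) := by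
  constructor
  · intro k hk
    have h1 : AddSubgroup.closure (Φ.root '' rootPlane Φ i j) ≤
        AddSubgroup.closure {Φ.root j, Φ.root i} := by
      rw [AddSubgroup.closure_le]
      rintro _ ⟨l, ⟨m, n, h⟩, rfl⟩
      exact AddSubgroup.mem_closure_pair.2 ⟨m, n, h.symm⟩
    obtain ⟨m, n, h⟩ := AddSubgroup.mem_closure_pair.1 (h1 hk)
    exact ⟨m, n, h.symm⟩
  · have h1 : Submodule.span ℝ (Φ.root '' rootPlane Φ i j) =
        Submodule.span ℝ (Set.range ![Φ.root i, Φ.root j]) := by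
      apply le_antisymm
      · rw [Submodule.span_le]
        rintro _ ⟨l, ⟨m, n, h⟩, rfl⟩
        rw [SetLike.mem_coe, Matrix.range_cons, Matrix.range_cons, Matrix.range_empty,
          Set.union_empty, Set.singleton_union, Submodule.mem_span_pair]
        refine ⟨n, m, ?_⟩
        rw [h, Int.cast_smul_eq_zsmul, Int.cast_smul_eq_zsmul, add_comm]
      · refine Submodule.span_mono ?_
        rintro _ ⟨l, rfl⟩
        fin_cases l
        · exact ⟨i, left_mem_rootPlane i j, rfl⟩
        · exact ⟨j, right_mem_rootPlane i j, rfl⟩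
    rw [h1, finrank_span_eq_card hij, Fintype.card_fin]

lemma IsRankTwoSubsystem.sameString {Ψ : Set ι} (h : IsRankTwoSubsystem Φ Ψ) {i j k : ι}
    (hi : i ∈ Ψ) (hj : j ∈ Ψ) (hjk : SameString Φ i j k) : k ∈ Ψ := by
  obtain ⟨n, hn⟩ := hjk
  apply h.1
  rw [hn]
  exact add_mem (AddSubgroup.subset_closure (Set.mem_image_of_mem _ hj))
    (zsmul_mem (AddSubgroup.subset_closure (Set.mem_image_of_mem _ hi)) n)

lemma IsRankTwoSubsystem.neg_mem {Ψ : Set ι} (h : IsRankTwoSubsystem Φ Ψ) {i : ι}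
    (hi : i ∈ Ψ) : Φ.reflectionPerm i i ∈ Ψ := by
  apply h.1
  rw [root_neg]
  exact AddSubgroup.neg_mem _ (AddSubgroup.subset_closure (Set.mem_image_of_mem _ hi))

variable [Fintype ι] {A : Type*} [Ring A] [Algebra ℂ A] {t : ι → A}

-- A subsystem containing `α_i` is a union of classes modulo `ℤα_i`, so its indicator is an
-- admissible `φ`; symmetry under negation makes the sum twice the one over positive roots.
open Classical in
lemma lie_sum_rankTwo_eq_zero (ht : ∀ i j, Φ.root j = -Φ.root i → t j = t i) (b : Φ.Base)
    (h : ∀ i, StringRel Φ t i) {Ψ : Set ι} (hΨ : IsRankTwoSubsystem Φ Ψ) {i : ι} (hi : i ∈ Ψ) :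
    ⁅t i, ∑ j ∈ (posRoots b).filter (fun j => j ∈ Ψ), t j⁆ = 0 := by
  have h1 := h i (fun j => if j ∈ Ψ then 1 else 0) fun j k hjk => if_congr
    ⟨fun hk => hΨ.sameString hi hk ((sameString_equivalence i).symm hjk),
      fun hj => hΨ.sameString hi hj hjk⟩ rfl rfl
  rw [sum_ite_mem_lie ht b i Ψ fun j => hΨ.neg_mem] at h1
  exact (smul_eq_zero.1 h1).resolve_left two_ne_zero

-- The relation for the subsystem `Φ ∩ (ℤα_i + ℤα_j)` is a sum over strings. The strings of `α_j`
-- and `-α_j` contribute equally; those of `mα_j + nα_i` with `m ≠ ±1` lie in strictly smaller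
-- subsystems, or are multiples of `α_i`, and vanish by induction.
open Classical in
lemma stringRel_of_rankTwo [Φ.IsReduced] (ht : ∀ i j, Φ.root j = -Φ.root i → t j = t i)
    (b : Φ.Base)
    (h : ∀ Ψ : Set ι, IsRankTwoSubsystem Φ Ψ → ∀ i ∈ Ψ,
      ⁅t i, ∑ j ∈ (posRoots b).filter (fun j => j ∈ Ψ), t j⁆ = 0) (i : ι) : StringRel Φ t i := by
  suffices key : ∀ j, stringSum Φ t i j = 0 from
    fun φ hφ => sum_smul_lie_eq_zero hφ fun j _ => key j
  intro j
  induction hN : (Finset.univ.filter (fun k => k ∈ rootPlane Φ i j)).card using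
    Nat.strong_induction_on generalizing j with
  | _ N ih =>
  subst hN
  by_cases hij : LinearIndependent ℝ ![Φ.root i, Φ.root j]
  swap
  · rcases RootPairing.IsReduced.eq_or_eq_neg i j hij with h1 | h1
    · rw [← Φ.root.injective h1, stringSum_self ht]
    · have : j = Φ.reflectionPerm i i := Φ.root.injective (by rw [root_neg, h1, neg_neg])
      rw [this, stringSum_neg ht, stringSum_self ht]
  have hli := LinearIndependent.pair_iff.1 hij
  have hΨ := isRankTwoSubsystem_rootPlane hij
  have hiΨ := left_mem_rootPlane (Φ := Φ) i j
  have hjΨ := right_mem_rootPlane (Φ := Φ) i j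
  have hsum := sum_ite_mem_lie ht b i _ fun j => hΨ.neg_mem
  rw [h _ hΨ i hiΨ, smul_zero] at hsum
  set j' := Φ.reflectionPerm j j with hj'
  -- A common member of both strings would put `2α_j` in `ℤα_i`.
  have hdisj : ∀ k, SameString Φ i j k → ¬ SameString Φ i j' k := by
    rintro k ⟨n, hn⟩ ⟨m, hm⟩
    rw [hj', root_neg, hn] at hm
    have := (hli ((n : ℝ) - m) 2 (by
      rw [sub_smul, Int.cast_smul_eq_zsmul, Int.cast_smul_eq_zsmul]
      linear_combination (norm := module) hm)).2
    norm_num at this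
  -- Here `φ` is the indicator of the subsystem with the strings of `α_j` and `-α_j` removed.
  have hrest := sum_smul_lie_eq_zero (Φ := Φ) (t := t) (i := i)
    (φ := fun k => (if k ∈ rootPlane Φ i j then 1 else 0 : ℂ) -
      (if SameString Φ i j k then 1 else 0) - if SameString Φ i j' k then 1 else 0) ?_ ?_
  · simp only [sub_smul, Finset.sum_sub_distrib] at hrest
    rw [hsum] at hrest
    simp only [ite_smul, one_smul, zero_smul, ← Finset.sum_filter] at hrest
    have h2 : (0 : A) - stringSum Φ t i j - stringSum Φ t i j' = 0 := hrest
    rw [hj', stringSum_neg ht] at h2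
    have h3 : (2 : ℂ) • stringSum Φ t i j = 0 := by
      rw [two_smul, ← neg_eq_zero, neg_add, ← sub_eq_add_neg, ← zero_sub]
      exact h2
    exact (smul_eq_zero.1 h3).resolve_left two_ne_zero
  · intro k l hkl
    have e := sameString_equivalence (Φ := Φ) i
    have h1 : l ∈ rootPlane Φ i j ↔ k ∈ rootPlane Φ i j :=
      ⟨fun h => hΨ.sameString hiΨ h (e.symm hkl), fun h => hΨ.sameString hiΨ h hkl⟩
    have h2 : ∀ m, SameString Φ i m l ↔ SameString Φ i m k :=
      fun m => ⟨fun h => e.trans h (e.symm hkl), fun h => e.trans h hkl⟩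
    simp only [h1, h2]
  · intro k hk
    by_cases h1 : SameString Φ i j k
    · exact absurd (by simp [hdisj k h1, h1, hΨ.sameString hiΨ hjΨ h1]) hk
    by_cases h2 : SameString Φ i j' k
    · exact absurd (by simp [h1, h2, hΨ.sameString hiΨ (hΨ.neg_mem hjΨ) h2]) hk
    by_cases h3 : k ∈ rootPlane Φ i j
    swap
    · exact absurd (by simp [h1, h2, h3]) hk
    obtain ⟨m, n, hmn⟩ := h3
    refine ih _ (Finset.card_lt_card ?_) k rfl
    rw [Finset.ssubset_iff_of_subset]
    -- If `α_j = m'α_k + n'α_i` with `α_k = mα_j + nα_i`, then `m'm = 1`, so `m = ±1` and `α_k` is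
    -- in one of the removed strings.
    · refine ⟨j, by simpa using hjΨ, fun hj => ?_⟩
      obtain ⟨m', n', hmn'⟩ := (Finset.mem_filter.1 hj).2
      rw [hmn] at hmn'
      have h4 := (hli ((m' * n + n' : ℤ) : ℝ) ((m' * m - 1 : ℤ) : ℝ) (by
        rw [Int.cast_smul_eq_zsmul, Int.cast_smul_eq_zsmul, sub_smul, one_smul]
        linear_combination (norm := module) -hmn')).2
      have h5 : m' * m = 1 := by
        have : m' * m - 1 = 0 := by exact_mod_cast h4
        omega
      rcases Int.isUnit_iff.1 (IsUnit.of_mul_eq_one_right _ h5) with rfl | rfl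
      · exact h1 ⟨n, by rw [hmn, one_smul]⟩
      · exact h2 ⟨n, by rw [hmn, hj', root_neg]; module⟩
    · intro l hl
      obtain ⟨m', n', hmn'⟩ := (Finset.mem_filter.1 hl).2
      refine Finset.mem_filter.2 ⟨Finset.mem_univ _, m' * m, m' * n + n', ?_⟩
      rw [hmn', hmn]
      module

end Planes

/-! ### Positive functionals -/

section Positivity

variable {ι V E : Type*} [AddCommGroup V] [Module ℝ V] [AddCommGroup E] [Module ℝ E]
variable {Φ : RootPairing ι ℝ V E} [Φ.IsRootSystem] (b : Φ.Base)

lemma exists_pos_functional : ∃ f : V →ₗ[ℝ] ℝ, ∀ j, b.IsPos j → 0 < f (Φ.root j) := by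
  refine ⟨∑ m, b.toWeightBasis.coord m, fun j hj => ?_⟩
  have hnn : ∀ m ∈ Finset.univ, 0 ≤ b.toWeightBasis.repr (Φ.root j) m :=
    fun m _ => toWeightBasis_repr_nonneg b hj m
  simp only [LinearMap.sum_apply, Module.Basis.coord_apply]
  refine lt_of_le_of_ne (Finset.sum_nonneg hnn) fun h => Φ.ne_zero j ?_
  rw [eq_comm, Finset.sum_eq_zero_iff_of_nonneg hnn] at h
  exact b.toWeightBasis.repr.map_eq_zero_iff.1 (Finsupp.ext fun m => h m (Finset.mem_univ m))

/-- The functional sums the simple-root coordinates other than that of `α_i`. A positive root on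
which it vanishes is a multiple of `α_i`, hence `α_i` itself as `Φ` is reduced. -/
lemma exists_pos_functional_of_simple [Φ.IsReduced] {i : ι} (hi : i ∈ b.support) :
    ∃ f : V →ₗ[ℝ] ℝ, f (Φ.root i) = 0 ∧ ∀ j, b.IsPos j → j ≠ i → 0 < f (Φ.root j) := by
  classical
  refine ⟨∑ m ∈ Finset.univ.erase ⟨i, hi⟩, b.toWeightBasis.coord m, ?_, fun j hj hji => ?_⟩
  · rw [LinearMap.sum_apply]
    refine Finset.sum_eq_zero fun m hm => ?_
    rw [Module.Basis.coord_apply, b.toWeightBasis_repr_root ⟨i, hi⟩,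
      Finsupp.single_eq_of_ne (Finset.ne_of_mem_erase hm)]
  · have hnn : ∀ m ∈ Finset.univ.erase ⟨i, hi⟩, 0 ≤ b.toWeightBasis.repr (Φ.root j) m :=
      fun m _ => toWeightBasis_repr_nonneg b hj m
    simp only [LinearMap.sum_apply, Module.Basis.coord_apply]
    refine lt_of_le_of_ne (Finset.sum_nonneg hnn) fun h => ?_
    rw [eq_comm, Finset.sum_eq_zero_iff_of_nonneg hnn] at h
    have h1 : Φ.root j = b.toWeightBasis.repr (Φ.root j) ⟨i, hi⟩ • Φ.root i := by
      conv_lhs => rw [← b.toWeightBasis.sum_repr (Φ.root j)]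
      rw [Finset.sum_eq_single_of_mem ⟨i, hi⟩ (Finset.mem_univ _), b.toWeightBasis_apply]
      intro m _ hm
      rw [h m (Finset.mem_erase.2 ⟨hm, Finset.mem_univ m⟩), zero_smul]
    have h2 := LinearIndependent.pair_iff.1 (linearIndependent_of_isPos
      (RootPairing.Base.isPos_of_mem_support hi) hj hji.symm)
      (b.toWeightBasis.repr (Φ.root j) ⟨i, hi⟩) (-1) (by rw [← h1]; module)
    simp at h2

end Positivity

/-! ### Consequences of the vanishing jump at a simple wall -/

section Jumps

variable {ι V E : Type*} [AddCommGroup V] [Module ℝ V] [AddCommGroup E] [Module ℝ E]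
variable {Φ : RootPairing ι ℝ V E} [Φ.IsCrystallographic]

/-- `(α_i ∧ α_j)(u, v)`. -/
def wedge (u v : Cartan Φ) (i j : ι) : ℂ :=
  u (rootWt Φ i) * v (rootWt Φ j) - v (rootWt Φ i) * u (rootWt Φ j)

lemma wedge_comm (u v : Cartan Φ) (i j : ι) : wedge u v j i = -wedge u v i j := by
  rw [wedge, wedge]; ring

/-- The vector `α_i(u) v - α_i(v) u` in the kernel of `α_i`. -/
def kerVec (u v : Cartan Φ) (i : ι) : Cartan Φ := u (rootWt Φ i) • v - v (rootWt Φ i) • u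

variable {A : Type*} [Ring A] [Algebra ℂ A]

lemma wedge_smul_lie_comm (t : ι → A) (u v : Cartan Φ) (i j : ι) :
    wedge u v j i • ⁅t j, t i⁆ = wedge u v i j • ⁅t i, t j⁆ := by
  rw [wedge_comm, ring_lie_comm, smul_neg, neg_smul, neg_neg]

variable [Fintype ι]

open Classical in
/-- The vanishing of the jump of the curvature across the wall of the simple root `α_i`, coefficient
by coefficient. -/
def JumpRel (b : Φ.Base) (t : ι → A) (τ : Cartan Φ →ₗ[ℂ] A) (i : ι) : Prop :=
  ∀ u v x, ∑ j ∈ (posRoots b).erase i,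
    (if ∃ (k : ℤ) (l : ℕ), 0 < l ∧ x = k • Φ.root i + l • Φ.root j then wedge u v i j else 0) •
      ⁅t i, t j⁆ +
    (if ∃ k : ℤ, x = k • Φ.root i then 1 else 0 : ℂ) • ⁅t i, τ (kerVec u v i)⁆ = 0

variable {b : Φ.Base} {t : ι → A} {τ : Cartan Φ →ₗ[ℂ] A} {i : ι}

/-- Induction on `f(α_j)`. At `x = α_j` the jump relation involves roots `α_k` with `α_j ∈ ℤα_i +
lα_k`, `l ≥ 1`: for `l = 1` they form the string of `α_j`, and for `l ≥ 2` they have smaller `f` and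
their strings are already known to vanish. -/
lemma JumpRel.stringSum_eq_zero (ht : ∀ i j, Φ.root j = -Φ.root i → t j = t i)
    (hi : i ∈ b.support) (h : JumpRel b t τ i) {f : V →ₗ[ℝ] ℝ} (hf : f (Φ.root i) = 0)
    (hpos : ∀ j, b.IsPos j → j ≠ i → 0 < f (Φ.root j)) (j : ι) (hj : b.IsPos j) (hji : j ≠ i) :
    stringSum Φ t i j = 0 := by
  classical
  induction hN : (Finset.univ.filter (fun k => f (Φ.root k) < f (Φ.root j))).card using
    Nat.strong_induction_on generalizing j with
  | _ N ih =>
  subst hN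
  have hfj := hpos j hj hji
  let φ : ι → ℂ := fun k => if ∃ (m : ℤ) (l : ℕ), 0 < l ∧
    Φ.root j = m • Φ.root i + l • Φ.root k then 2 * (f (Φ.root k) : ℂ) else 0
  have hφf : ∀ {k} {m : ℤ} {l : ℕ}, Φ.root j = m • Φ.root i + l • Φ.root k →
      f (Φ.root j) = l * f (Φ.root k) := by
    intro k m l hk
    rw [hk, map_add, map_zsmul, hf, smul_zero, zero_add, map_nsmul, nsmul_eq_mul]
  have hφpos : ∀ {k} {m : ℤ} {l : ℕ}, Φ.root j = m • Φ.root i + l • Φ.root k →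
      0 < f (Φ.root k) := by
    intro k m l hk
    rw [hφf hk] at hfj
    exact (pos_iff_pos_of_mul_pos hfj).1 ((Nat.cast_nonneg l).lt_of_ne fun h0 => by
      rw [← h0, zero_mul] at hfj
      exact hfj.false)
  have hφc : ∀ k k', SameString Φ i k k' → φ k' = φ k := by
    rintro k k' ⟨n, hn⟩
    have h1 : f (Φ.root k') = f (Φ.root k) := by
      rw [hn, map_add, map_zsmul, hf, smul_zero, add_zero]
    simp only [φ, h1]
    refine if_congr ⟨?_, ?_⟩ rfl rfl
    · rintro ⟨m, l, hl, hm⟩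
      exact ⟨m + l * n, l, hl, by rw [hm, hn]; module⟩
    · rintro ⟨m, l, hl, hm⟩
      exact ⟨m - l * n, l, hl, by rw [hm, hn]; module⟩
  have hsum : ∑ k, φ k • ⁅t i, t k⁆ = 0 := by
    -- With `u = α_i^∨` and `v = f` one has `α_i(u) = 2` and `α_i(v) = 0`, so `(α_i ∧ α_k)(u, v) = 2
    -- f(α_k)`, which is constant on strings and nonzero on that of `α_j`.
    have h1 := h (realCartan (Φ.toLinearMap.flip (Φ.coroot i))) (realCartan f) (Φ.root j)
    rw [if_neg, zero_smul, add_zero] at h1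
    · rw [← h1, sum_eq_sum_posRoots b, sum_posRoots_eq_add_erase b hi, ring_lie_self, smul_zero,
        ht _ _ (root_neg i), ring_lie_self, smul_zero, add_zero, zero_add]
      refine Finset.sum_congr rfl fun k hk => ?_
      rw [Finset.mem_erase, mem_posRoots] at hk
      have h2 : φ (Φ.reflectionPerm k k) = 0 := if_neg fun ⟨m, l, _, hm⟩ => by
        have h3 := hφpos hm
        rw [root_neg, map_neg] at h3
        exact (hpos k hk.2 hk.1).not_gt (neg_pos.1 h3)
      rw [h2, zero_smul, add_zero]
      congr 1
      refine if_congr Iff.rfl ?_ rfl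
      simp [wedge, realCartan_rootWt, hf]
    · rintro ⟨k, hk⟩
      rw [hk, map_zsmul, hf, smul_zero] at hfj
      exact hfj.false
  have hrest := sum_smul_lie_eq_zero (Φ := Φ) (t := t) (i := i)
    (φ := fun k => φ k - φ j * if SameString Φ i j k then 1 else 0) ?_ ?_
  · simp only [sub_smul, Finset.sum_sub_distrib, hsum, mul_smul, ← Finset.smul_sum] at hrest
    simp only [ite_smul, one_smul, zero_smul, ← Finset.sum_filter] at hrest
    have h2 : (0 : A) - φ j • stringSum Φ t i j = 0 := hrest
    rw [zero_sub, neg_eq_zero] at h2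
    refine (smul_eq_zero.1 h2).resolve_left ?_
    have h3 : φ j = 2 * (f (Φ.root j) : ℂ) := if_pos ⟨0, 1, one_pos, by simp⟩
    rw [h3]
    exact mul_ne_zero two_ne_zero (by exact_mod_cast hfj.ne')
  · intro k l hkl
    have e := sameString_equivalence (Φ := Φ) i
    have h2 : SameString Φ i j l ↔ SameString Φ i j k :=
      ⟨fun h => e.trans h (e.symm hkl), fun h => e.trans h hkl⟩
    simp only [h2, hφc k l hkl]
  · intro k hk
    by_cases h1 : SameString Φ i j k
    · exact absurd (by simp [h1, hφc j k h1]) hk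
    by_cases h2 : ∃ (m : ℤ) (l : ℕ), 0 < l ∧ Φ.root j = m • Φ.root i + l • Φ.root k
    swap
    · exact absurd (by simp [h1, φ, h2]) hk
    obtain ⟨m, l, hl, hm⟩ := h2
    have hl1 : l ≠ 1 := by
      rintro rfl
      exact h1 ⟨-m, by rw [hm]; module⟩
    have hk0 := hφpos hm
    have hlt : f (Φ.root k) < f (Φ.root j) := by
      rw [hφf hm]
      have : (2 : ℝ) ≤ l := by exact_mod_cast (by omega : 2 ≤ l)
      nlinarith
    have hki : k ≠ i := by
      rintro rfl
      exact hk0.ne' hf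
    have hkp : b.IsPos k := by
      by_contra hn
      have h3 := hpos _ ((isPos_neg_iff b k).2 hn) fun h4 => by
        have h5 := congrArg f (root_neg (Φ := Φ) k)
        rw [h4, hf, map_neg] at h5
        linarith
      rw [root_neg, map_neg] at h3
      linarith
    refine ih _ (Finset.card_lt_card ?_) k hkp hki rfl
    rw [Finset.ssubset_iff_of_subset]
    · exact ⟨k, by simpa using hlt, by simp⟩
    · intro l hl
      rw [Finset.mem_filter] at hl ⊢
      exact ⟨hl.1, hl.2.trans hlt⟩

variable [Φ.IsRootSystem] [Φ.IsReduced]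

lemma JumpRel.lie_eq_zero (hi : i ∈ b.support) (h : JumpRel b t τ i) (u : Cartan Φ)
    (hu : u (rootWt Φ i) = 0) : ⁅t i, τ u⁆ = 0 := by
  classical
  obtain ⟨v, hv⟩ := exists_cartan_ne_zero (Φ := Φ) i
  obtain ⟨f, hf, hpos⟩ := exists_pos_functional_of_simple b hi
  -- At `x = 0` the sum over roots is empty: `f` vanishes on `α_i` but is positive on `lα_j`.
  have h1 := h u v 0
  rw [if_pos ⟨0, (zero_smul _ _).symm⟩, Finset.sum_eq_zero, zero_add, one_smul, kerVec, hu,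
    zero_smul, zero_sub, ← neg_smul, map_smul, ring_lie_smul] at h1
  · exact (smul_eq_zero.1 h1).resolve_left (neg_ne_zero.2 hv)
  · intro j hj
    rw [Finset.mem_erase, mem_posRoots] at hj
    rw [if_neg, zero_smul]
    rintro ⟨k, l, hl, hkl⟩
    have h2 := congrArg f hkl
    rw [map_zero, map_add, map_zsmul, hf, smul_zero, zero_add, map_nsmul] at h2
    exact (nsmul_pos (hpos j hj.2 hj.1) hl.ne').ne h2

lemma JumpRel.stringRel (ht : ∀ i j, Φ.root j = -Φ.root i → t j = t i)
    (hi : i ∈ b.support) (h : JumpRel b t τ i) : StringRel Φ t i := by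
  obtain ⟨f, hf, hpos⟩ := exists_pos_functional_of_simple b hi
  have key : ∀ j, b.IsPos j → stringSum Φ t i j = 0 := by
    intro j hj
    by_cases hji : j = i
    · rw [hji, stringSum_self ht]
    · exact h.stringSum_eq_zero ht hi hf hpos j hj hji
  refine fun φ hφ => sum_smul_lie_eq_zero hφ fun j _ => ?_
  by_cases hj : b.IsPos j
  · exact key j hj
  · rw [← stringSum_neg ht, key _ ((isPos_neg_iff b j).2 hj)]

end Jumps

section

variable {ι V E : Type*} [Fintype ι] [AddCommGroup V] [Module ℝ V] [AddCommGroup E] [Module ℝ E]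
variable {Φ : RootPairing ι ℝ V E} [Φ.IsCrystallographic]
variable {A : Type*} [Ring A] [Algebra ℂ A] {b : Φ.Base} {t : ι → A} {τ : Cartan Φ →ₗ[ℂ] A}

/-! ### Coefficients of the curvature -/

section Curvature

/-- The factor `2` avoids halves: averaging the double sum with its transpose replaces `α_i(u)
α_j(v)` by the wedge. -/
lemma extendFunctional_lie (c : RegRing Φ →ₗ[ℂ] ℂ) (u v : Cartan Φ) :
    (2 : ℂ) • extendFunctional c ⁅connForm Φ b t τ u, connForm Φ b t τ v⁆ =
      ∑ i ∈ posRoots b, ∑ j ∈ posRoots b,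
        c (invDenom Φ i * invDenom Φ j) • wedge u v i j • ⁅t i, t j⁆ +
      (2 : ℂ) • (∑ i ∈ posRoots b, c (invDenom Φ i) • ⁅t i, τ (kerVec u v i)⁆ +
        c 1 • ⁅τ u, τ v⁆) := by
  have h1 : extendFunctional c ⁅connForm Φ b t τ u, connForm Φ b t τ v⁆ =
      ∑ i ∈ posRoots b, ∑ j ∈ posRoots b, (c (invDenom Φ i * invDenom Φ j) *
        (u (rootWt Φ i) * v (rootWt Φ j))) • ⁅t i, t j⁆ +
      (∑ i ∈ posRoots b, c (invDenom Φ i) • ⁅t i, τ (kerVec u v i)⁆ + c 1 • ⁅τ u, τ v⁆) := by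
    have hR : ∀ (r s : RegRing Φ) (x y : A), (r ⊗ₜ[ℂ] x) * (s ⊗ₜ y) - (s ⊗ₜ y) * (r ⊗ₜ x) =
        (r * s) ⊗ₜ ⁅x, y⁆ := by
      intro r s x y
      rw [Algebra.TensorProduct.tmul_mul_tmul, Algebra.TensorProduct.tmul_mul_tmul, mul_comm s,
        ← TensorProduct.tmul_sub, Ring.lie_def]
    have hF : ⁅connForm Φ b t τ u, connForm Φ b t τ v⁆ =
        ∑ i ∈ posRoots b, ∑ j ∈ posRoots b, ((u (rootWt Φ i) • invDenom Φ i) *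
          (v (rootWt Φ j) • invDenom Φ j)) ⊗ₜ[ℂ] ⁅t i, t j⁆ +
        (∑ i ∈ posRoots b, ((u (rootWt Φ i) • invDenom Φ i) * 1) ⊗ₜ[ℂ] ⁅t i, τ v⁆ +
         ∑ i ∈ posRoots b, (1 * (v (rootWt Φ i) • invDenom Φ i)) ⊗ₜ[ℂ] ⁅τ u, t i⁆ +
          (1 * 1) ⊗ₜ ⁅τ u, τ v⁆) := by
      simp only [← hR, Finset.sum_sub_distrib]
      rw [Finset.sum_comm (f := fun i j => (v (rootWt Φ j) • invDenom Φ j) ⊗ₜ[ℂ] t j *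
        (u (rootWt Φ i) • invDenom Φ i) ⊗ₜ[ℂ] t i)]
      simp only [← Finset.mul_sum, ← Finset.sum_mul]
      rw [Ring.lie_def, connForm, connForm]
      noncomm_ring
    rw [hF]
    simp only [map_add, map_sum, extendFunctional_tmul, mul_one, one_mul, map_smul,
      smul_mul_smul_comm]
    rw [← Finset.sum_add_distrib]
    congr 1
    · exact Finset.sum_congr rfl fun i _ => Finset.sum_congr rfl fun j _ => by
        rw [smul_eq_mul, mul_comm]
    · refine congrArg (· + _) (Finset.sum_congr rfl fun i _ => ?_)
      rw [kerVec, map_sub, map_smul, map_smul, ring_lie_comm (τ u)]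
      simp only [Ring.lie_def, smul_eq_mul, mul_sub, sub_mul, mul_smul_comm, smul_mul_assoc,
        smul_sub, smul_neg, mul_smul, smul_comm (c _)]
      abel
  have h2 : ∑ i ∈ posRoots b, ∑ j ∈ posRoots b, (c (invDenom Φ i * invDenom Φ j) *
        (u (rootWt Φ i) * v (rootWt Φ j))) • ⁅t i, t j⁆ =
      -∑ i ∈ posRoots b, ∑ j ∈ posRoots b, (c (invDenom Φ i * invDenom Φ j) *
        (v (rootWt Φ i) * u (rootWt Φ j))) • ⁅t i, t j⁆ := by
    rw [Finset.sum_comm, ← Finset.sum_neg_distrib]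
    refine Finset.sum_congr rfl fun i _ => ?_
    rw [← Finset.sum_neg_distrib]
    refine Finset.sum_congr rfl fun j _ => ?_
    rw [ring_lie_comm, smul_neg, mul_comm (invDenom Φ j), mul_comm (u _)]
  rw [h1, smul_add, two_smul ℂ (∑ i ∈ posRoots b, _)]
  congr 1
  nth_rewrite 2 [h2]
  rw [← sub_eq_add_neg, ← Finset.sum_sub_distrib]
  refine Finset.sum_congr rfl fun i _ => ?_
  rw [← Finset.sum_sub_distrib]
  refine Finset.sum_congr rfl fun j _ => ?_
  rw [← sub_smul, ← mul_sub, mul_smul, wedge]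

end Curvature

/-! ### The jump across a simple wall -/

section Jump

variable [Φ.IsReduced]

/-- Terms without `1/(e^{α_i} - 1)` have the same expansion in both chambers adjacent to the wall of
`α_i`; the remaining factor jumps by `∑_{k ∈ ℤ} e^{kα_i}`. -/
lemma jumpRel_of_lie_eq_zero {cf : V → RegRing Φ →ₗ[ℂ] ℂ} (hcf : IsExpansion b cf)
    [Φ.IsRootSystem]
    (h : ∀ u v, ⁅connForm Φ b t τ u, connForm Φ b t τ v⁆ = 0) {i : ι} (hi : i ∈ b.support) :
    JumpRel b t τ i := by
  classical
  intro u v x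
  have hip := RootPairing.Base.isPos_of_mem_support hi
  obtain ⟨f, hf, hpos⟩ := exists_pos_functional_of_simple b hi
  set s := RootPairing.weylGroup.ofIdx Φ i with hs
  -- The coefficient of `e^{-x}` in the given chamber minus that in its image under `s_i`.
  let c : RegRing Φ →ₗ[ℂ] ℂ := cf x - cf (Φ.reflection i x) ∘ₗ (weylFun Φ s).toLinearMap
  have hc : ∀ r, c r = cf x r - cf (Φ.reflection i x) (weylFun Φ s r) := fun _ => rfl
  have hinv : ∀ y, Φ.reflection i x = y ↔ x = Φ.reflection i y := by
    intro y
    constructor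
    · rintro rfl; simp
    · rintro rfl; simp
  have hw : ∀ j, weylFun Φ s (invDenom Φ j) = invDenom Φ (Φ.reflectionPerm i j) :=
    fun j => weylFun_invDenom Φ s j
  have hwi : weylFun Φ s (invDenom Φ i) = -1 - invDenom Φ i := by
    rw [hw, invDenom_neg Φ (root_neg i)]
  have hmem : ∀ {j}, j ∈ (posRoots b).erase i → b.IsPos j ∧ j ≠ i ∧
      b.IsPos (Φ.reflectionPerm i j) ∧ Φ.reflectionPerm i j ≠ i := by
    intro j hj
    have hj' := reflectionPerm_mem_posRoots_erase b hi hj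
    rw [Finset.mem_erase, mem_posRoots] at hj hj'
    exact ⟨hj.2, hj.1, hj'.2, hj'.1⟩
  have hri : Φ.reflection i (Φ.root i) = -Φ.root i := by simp
  have cf_one : ∀ y, cf y 1 = if y = 0 then 1 else 0 := by
    intro y
    split_ifs with hy
    · rw [hy, hcf.one_zero]
    · exact hcf.one_of_ne y hy
  have c_one : c 1 = 0 := by
    rw [hc, map_one (weylFun Φ s), cf_one, cf_one, sub_eq_zero]
    exact if_congr (by simp) rfl rfl
  have c_inv : ∀ j ∈ (posRoots b).erase i, c (invDenom Φ j) = 0 := by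
    intro j hj
    obtain ⟨hj1, -, hj3, -⟩ := hmem hj
    rw [hc, hw, hcf.invDenom_eq _ _ hj1, hcf.invDenom_eq _ _ hj3, sub_eq_zero]
    refine if_congr (exists_congr fun k => and_congr_right fun _ => ?_) rfl rfl
    rw [hinv, map_nsmul, ← RootPairing.root_reflectionPerm, Φ.reflectionPerm_self]
  have c_inv_i : c (invDenom Φ i) = if ∃ k : ℤ, x = k • Φ.root i then 1 else 0 := by
    have hne : ∀ k : ℤ, k • Φ.root i = 0 → k = 0 := fun k hk => by
      rw [← Int.cast_smul_eq_zsmul ℝ] at hk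
      exact_mod_cast (smul_eq_zero.1 hk).resolve_right (Φ.ne_zero i)
    rw [hc, hwi, map_sub, map_neg, cf_one, hcf.invDenom_eq _ _ hip, hcf.invDenom_eq _ _ hip]
    simp only [hinv, map_zero, map_nsmul, hri]
    by_cases hx : ∃ k : ℤ, x = k • Φ.root i
    · rw [if_pos hx]
      obtain ⟨k, rfl⟩ := hx
      -- For `k > 0` the coefficient comes from the given chamber, for `k < 0` from the reflected
      -- one, and for `k = 0` from the constant `-1` in `hwi`. The same trichotomy governs
      -- `c_mul_i`.
      rcases lt_trichotomy k 0 with hk | hk | hk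
      · rw [if_neg, if_neg, if_pos]
        · simp
        · exact ⟨k.natAbs, by omega, by
            rw [smul_neg, ← natCast_zsmul, ← neg_smul]
            congr 1
            omega⟩
        · exact fun h0 => hk.ne (hne k h0)
        · rintro ⟨m, hm, h0⟩
          rw [← natCast_zsmul, ← sub_eq_zero, ← sub_smul] at h0
          have := hne _ h0
          omega
      · subst hk
        rw [if_neg, if_pos (zero_smul _ _), if_neg]
        · simp
        · rintro ⟨m, hm, h0⟩
          rw [smul_neg, ← natCast_zsmul, ← neg_smul, ← sub_eq_zero, ← sub_smul] at h0
          have := hne _ h0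
          omega
        · rintro ⟨m, hm, h0⟩
          rw [← natCast_zsmul, ← sub_eq_zero, ← sub_smul] at h0
          have := hne _ h0
          omega
      · rw [if_pos, if_neg, if_neg]
        · simp
        · rintro ⟨m, hm, h0⟩
          rw [smul_neg, ← natCast_zsmul, ← neg_smul, ← sub_eq_zero, ← sub_smul] at h0
          have := hne _ h0
          omega
        · exact fun h0 => hk.ne' (hne k h0)
        · exact ⟨k.natAbs, by omega, by
            rw [← natCast_zsmul]
            congr 1
            omega⟩
    · rw [if_neg hx, if_neg, if_neg, if_neg]
      · simp
      · rintro ⟨m, -, h0⟩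
        exact hx ⟨-m, by rw [h0]; module⟩
      · exact fun h0 => hx ⟨0, by rw [h0, zero_smul]⟩
      · rintro ⟨m, -, h0⟩
        exact hx ⟨m, by rw [h0]; module⟩
  have c_mul : ∀ j ∈ (posRoots b).erase i, ∀ k ∈ (posRoots b).erase i, j ≠ k →
      c (invDenom Φ j * invDenom Φ k) = 0 := by
    intro j hj k hk hjk
    obtain ⟨hj1, -, hj3, -⟩ := hmem hj
    obtain ⟨hk1, -, hk3, -⟩ := hmem hk
    rw [hc, map_mul (weylFun Φ s), hw, hw, hcf.invDenom_mul_eq _ _ _ hj1 hk1 hjk,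
      hcf.invDenom_mul_eq _ _ _ hj3 hk3 ((Φ.reflectionPerm i).injective.ne hjk), sub_eq_zero]
    refine if_congr (exists₂_congr fun m n => and_congr_right fun _ => and_congr_right fun _ => ?_)
      rfl rfl
    rw [hinv, map_add, map_nsmul, map_nsmul, ← RootPairing.root_reflectionPerm,
      ← RootPairing.root_reflectionPerm, Φ.reflectionPerm_self, Φ.reflectionPerm_self]
  have c_mul_i : ∀ j ∈ (posRoots b).erase i, c (invDenom Φ i * invDenom Φ j) =
      if ∃ (k : ℤ) (l : ℕ), 0 < l ∧ x = k • Φ.root i + l • Φ.root j then 1 else 0 := by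
    intro j hj
    obtain ⟨hj1, hj2, hj3, hj4⟩ := hmem hj
    have hfj := hpos j hj1 hj2
    have hli := LinearIndependent.pair_iff.1 (linearIndependent_of_isPos hip hj1 hj2.symm)
    have huniq : ∀ (k k' : ℤ) (l l' : ℕ), k • Φ.root i + l • Φ.root j =
        k' • Φ.root i + l' • Φ.root j → k = k' := by
      intro k k' l l' h0
      have h3 := (hli ((k : ℝ) - k') ((l : ℝ) - l') (by
        rw [sub_smul, sub_smul, Int.cast_smul_eq_zsmul, Int.cast_smul_eq_zsmul,
          Nat.cast_smul_eq_nsmul, Nat.cast_smul_eq_nsmul, sub_add_sub_comm, h0, sub_self])).1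
      exact_mod_cast sub_eq_zero.1 h3
    rw [hc, map_mul (weylFun Φ s), hwi, hw, sub_mul, neg_one_mul, map_sub, map_neg,
      hcf.invDenom_mul_eq _ _ _ hip hj1 hj2.symm, hcf.invDenom_mul_eq _ _ _ hip hj3 hj4.symm,
      hcf.invDenom_eq _ _ hj3]
    simp only [hinv, map_add, map_nsmul, hri, ← RootPairing.root_reflectionPerm,
      Φ.reflectionPerm_self]
    by_cases hx : ∃ (k : ℤ) (l : ℕ), 0 < l ∧ x = k • Φ.root i + l • Φ.root j
    · rw [if_pos hx]
      obtain ⟨k, l, hl, rfl⟩ := hx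
      rcases lt_trichotomy k 0 with hk | hk | hk
      · rw [if_neg, if_neg, if_pos]
        · simp
        · exact ⟨k.natAbs, l, by omega, hl, by
            rw [smul_neg, ← natCast_zsmul (Φ.root i), ← neg_smul,
              show -(k.natAbs : ℤ) = k by omega]⟩
        · rintro ⟨l', -, h0⟩
          have := huniq k 0 l l' (by rw [h0]; module)
          omega
        · rintro ⟨k', l', hk', -, h0⟩
          have := huniq k k' l l' (by rw [h0]; module)
          omega
      · subst hk
        rw [if_neg, if_pos, if_neg]
        · simp
        · rintro ⟨k', l', hk', -, h0⟩
          have := huniq 0 (-k') l l' (by rw [h0]; module)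
          omega
        · exact ⟨l, hl, by module⟩
        · rintro ⟨k', l', hk', -, h0⟩
          have := huniq 0 k' l l' (by rw [h0]; module)
          omega
      · rw [if_pos, if_neg, if_neg]
        · simp
        · rintro ⟨k', l', hk', -, h0⟩
          have := huniq k (-k') l l' (by rw [h0]; module)
          omega
        · rintro ⟨l', -, h0⟩
          have := huniq k 0 l l' (by rw [h0]; module)
          omega
        · exact ⟨k.natAbs, l, by omega, hl, by
            rw [← natCast_zsmul (Φ.root i), show (k.natAbs : ℤ) = k by omega]⟩
    · rw [if_neg hx, if_neg, if_neg, if_neg]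
      · simp
      · rintro ⟨k, l, -, hl, h0⟩
        exact hx ⟨-k, l, hl, by rw [h0]; module⟩
      · rintro ⟨l, hl, h0⟩
        exact hx ⟨0, l, hl, by rw [h0]; module⟩
      · rintro ⟨k, l, -, hl, h0⟩
        exact hx ⟨k, l, hl, by rw [h0]; module⟩
  have h1 := extendFunctional_lie (b := b) (t := t) (τ := τ) c u v
  rw [h, map_zero, smul_zero, c_one, zero_smul, add_zero, sum_posRoots_eq_add_erase b hi,
    sum_posRoots_eq_add_erase b hi, sum_posRoots_eq_add_erase b hi, ring_lie_self, smul_zero,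
    smul_zero, zero_add, c_inv_i, Finset.sum_eq_zero (s := (posRoots b).erase i)
      (f := fun j => c (invDenom Φ j) • _) fun j hj => by rw [c_inv j hj, zero_smul], add_zero]
    at h1
  have h2 : ∑ j ∈ (posRoots b).erase i, ∑ k ∈ posRoots b,
      c (invDenom Φ j * invDenom Φ k) • wedge u v j k • ⁅t j, t k⁆ =
      ∑ j ∈ (posRoots b).erase i, c (invDenom Φ i * invDenom Φ j) • wedge u v i j • ⁅t i, t j⁆ := by
    refine Finset.sum_congr rfl fun j hj => ?_
    rw [sum_posRoots_eq_add_erase b hi, Finset.sum_eq_zero, add_zero, mul_comm,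
      wedge_smul_lie_comm]
    intro k hk
    by_cases hjk : j = k
    · rw [hjk, ring_lie_self, smul_zero, smul_zero]
    · rw [c_mul j hj k hk hjk, zero_smul]
  rw [h2, ← two_smul ℂ, ← smul_add, eq_comm] at h1
  have h3 := (smul_eq_zero.1 h1).resolve_left two_ne_zero
  rw [← h3]
  congr 1
  refine Finset.sum_congr rfl fun j hj => ?_
  rw [c_mul_i j hj]
  split_ifs <;> simp

end Jump

end

section

variable {ι V E : Type*} [Fintype ι] [AddCommGroup V] [Module ℝ V] [AddCommGroup E] [Module ℝ E]
variable {Φ : RootPairing ι ℝ V E} [Φ.IsCrystallographic] [Φ.IsReduced]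
variable {A : Type*} [Ring A] [Algebra ℂ A] {b : Φ.Base} {t : ι → A} {τ : Cartan Φ →ₗ[ℂ] A}

/-! ### Commutation of `t_α` with `δ` on `Ker α` -/

section Delta

lemma lie_delta_eq_zero (ht : ∀ i j, Φ.root j = -Φ.root i → t j = t i)
    {ρ : Φ.weylGroup →* (A ≃ₐ[ℂ] A)} (hd : TEquivariant Φ b ρ t)
    (hδ : ∀ (w : Φ.weylGroup) (v : Cartan Φ),
      ρ w (delta Φ b t τ v) = delta Φ b t τ (weylCartan Φ w v))
    (h : ∀ i ∈ b.support, ∀ u : Cartan Φ, u (rootWt Φ i) = 0 → ⁅t i, delta Φ b t τ u⁆ = 0)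
    (i : ι) : ∀ u : Cartan Φ, u (rootWt Φ i) = 0 → ⁅t i, delta Φ b t τ u⁆ = 0 := by
  refine b.induction_reflect i (p := fun i => ∀ u : Cartan Φ, u (rootWt Φ i) = 0 →
    ⁅t i, delta Φ b t τ u⁆ = 0) (fun i hi u hu => ?_) h fun i j hi hj u hu => ?_
  · rw [cartan_rootWt_neg (root_neg i), neg_eq_zero] at hu
    rw [ht _ _ (root_neg i)]
    exact hi u hu
  · set s := RootPairing.weylGroup.ofIdx Φ j with hs
    have h1 : weylCartan Φ s (weylCartan Φ s⁻¹ u) = u := by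
      rw [← weylCartan_mul, mul_inv_cancel, weylCartan_one]
    have h2 := hi (weylCartan Φ s⁻¹ u) (by
      rw [← weylCartan_ofIdx_rootWt j i, ← hs, h1, hu])
    have h3 := congrArg (ρ s) h2
    rwa [Ring.lie_def, map_sub, map_mul, map_mul, hδ, h1, hs, hd j hj, map_zero,
      ← Ring.lie_def] at h3

variable [Φ.IsRootSystem]

/-- By (c) it remains to see that `∑_{β > 0} β(u) [t_{α_i}, t_β] = 0`. This is half of a string
relation whose coefficient `±β(u)` has the sign of `f(β)`: since `u` and `f` vanish on `α_i`, it is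
constant on strings. -/
lemma lie_delta_eq_zero_of_simple (ht : ∀ i j, Φ.root j = -Φ.root i → t j = t i)
    {i : ι} (hi : i ∈ b.support) (hs : StringRel Φ t i)
    (hc : ∀ u : Cartan Φ, u (rootWt Φ i) = 0 → ⁅t i, τ u⁆ = 0) (u : Cartan Φ)
    (hu : u (rootWt Φ i) = 0) : ⁅t i, delta Φ b t τ u⁆ = 0 := by
  classical
  obtain ⟨f, hf, hpos⟩ := exists_pos_functional_of_simple b hi
  have h1 := hs (fun j => if 0 < f (Φ.root j) then u (rootWt Φ j) else
    if f (Φ.root j) < 0 then -u (rootWt Φ j) else 0) fun j k ⟨n, hn⟩ => by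
      have h2 : f (Φ.root k) = f (Φ.root j) := by
        rw [hn, map_add, map_zsmul, hf, smul_zero, add_zero]
      have h3 : u (rootWt Φ k) = u (rootWt Φ j) := by
        rw [show rootWt Φ k = rootWt Φ j + n • rootWt Φ i from Subtype.ext hn, map_add,
          map_zsmul, hu, smul_zero, add_zero]
      simp only [h2, h3]
  have h2 : ∑ j ∈ posRoots b, u (rootWt Φ j) • ⁅t i, t j⁆ = 0 := by
    refine (smul_eq_zero.1 ?_).resolve_left (two_ne_zero (α := ℂ))
    rw [← h1, sum_eq_sum_posRoots b, Finset.smul_sum]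
    refine Finset.sum_congr rfl fun j hj => ?_
    by_cases hji : j = i
    · simp [hji, hf, hu]
    · have hfj := hpos j ((mem_posRoots b).1 hj) hji
      rw [if_pos hfj, root_neg, map_neg, if_neg (by linarith), if_pos (by linarith),
        cartan_rootWt_neg (root_neg j), neg_neg, ht _ _ (root_neg j), two_smul]
  have h3 : ⁅t i, delta Φ b t τ u⁆ = ⁅t i, τ u⁆ -
      (1 / 2 : ℂ) • ∑ j ∈ posRoots b, u (rootWt Φ j) • ⁅t i, t j⁆ := by
    simp only [← ring_lie_smul, ← ring_lie_sum]
    rw [delta]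
    simp only [Ring.lie_def]
    noncomm_ring
  rw [h3, hc u hu, h2, smul_zero, sub_zero]

end Delta

/-! ### Coefficient identities from the string relations -/

section Coefficients

-- For fixed `i` the string relation is applied with `φ(j) = (α_i ∧ α_j)(u, v)` if `x ∈ ℤα_i + lα_j`
-- for some `l > 0`, and `0` otherwise. Splitting by the sign of the coefficient of `α_i` gives the
-- two sums of the statement and terms with differences of positive multiples, which cancel after
-- summing over `i`.
open Classical in
lemma sum_pair_coeff_eq_zero (ht : ∀ i j, Φ.root j = -Φ.root i → t j = t i)
    (hs : ∀ i, StringRel Φ t i) {f : V →ₗ[ℝ] ℝ} (hf : ∀ j, b.IsPos j → 0 < f (Φ.root j))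
    {x : V} (hx : 0 < f x) (u v : Cartan Φ) :
    ∑ i ∈ posRoots b, ∑ j ∈ posRoots b,
      (if ∃ k l : ℕ, 0 < k ∧ 0 < l ∧ x = k • Φ.root i + l • Φ.root j then 1 else 0 : ℂ) •
        wedge u v i j • ⁅t i, t j⁆ +
    ∑ i ∈ posRoots b, ∑ j ∈ posRoots b,
      (if ∃ l : ℕ, 0 < l ∧ x = l • Φ.root j then 1 else 0 : ℂ) • wedge u v i j • ⁅t i, t j⁆
      = 0 := by
  let E' : ι → ι → ℂ := fun i j =>
    if ∃ k l : ℕ, 0 < k ∧ 0 < l ∧ x = l • Φ.root j - k • Φ.root i then 1 else 0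
  have hrow : ∀ i ∈ posRoots b, ∑ j ∈ posRoots b,
      ((if ∃ k l : ℕ, 0 < k ∧ 0 < l ∧ x = k • Φ.root i + l • Φ.root j then 1 else 0 : ℂ) +
        (if ∃ l : ℕ, 0 < l ∧ x = l • Φ.root j then 1 else 0) + E' i j - E' j i) •
          wedge u v i j • ⁅t i, t j⁆ = 0 := by
    intro i hi
    rw [mem_posRoots] at hi
    have h1 := hs i (fun j => (if ∃ (k : ℤ) (l : ℕ), 0 < l ∧
      x = k • Φ.root i + l • Φ.root j then 1 else 0) * wedge u v i j) fun j k ⟨n, hn⟩ => by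
        have hk : rootWt Φ k = rootWt Φ j + n • rootWt Φ i := Subtype.ext hn
        congr 1
        · refine if_congr ⟨?_, ?_⟩ rfl rfl
          · rintro ⟨m, l, hl, hm⟩
            exact ⟨m + l * n, l, hl, by rw [hm, hn]; module⟩
          · rintro ⟨m, l, hl, hm⟩
            exact ⟨m - l * n, l, hl, by rw [hm, hn]; module⟩
        · simp only [wedge, hk, map_add, map_zsmul, zsmul_eq_mul]
          ring
    rw [← h1, sum_eq_sum_posRoots b]
    refine Finset.sum_congr rfl fun j hj => ?_
    rw [mem_posRoots] at hj
    by_cases hij : i = j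
    · subst hij
      simp [ring_lie_self, ht _ _ (root_neg i)]
    have hfi := hf i hi
    have hfj := hf j hj
    have hw : wedge u v i (Φ.reflectionPerm j j) = -wedge u v i j := by
      rw [wedge, wedge, cartan_rootWt_neg (root_neg j), cartan_rootWt_neg (root_neg j)]
      ring
    have huniq : ∀ (k k' : ℤ) (l l' : ℕ), k • Φ.root i + l • Φ.root j =
        k' • Φ.root i + l' • Φ.root j → k = k' := by
      intro k k' l l' h0
      have h3 := (LinearIndependent.pair_iff.1 (linearIndependent_of_isPos hi hj hij)
        ((k : ℝ) - k') ((l : ℝ) - l') (by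
          rw [sub_smul, sub_smul, Int.cast_smul_eq_zsmul, Int.cast_smul_eq_zsmul,
            Nat.cast_smul_eq_nsmul, Nat.cast_smul_eq_nsmul, sub_add_sub_comm, h0, sub_self])).1
      exact_mod_cast sub_eq_zero.1 h3
    have hneg : (if ∃ (k : ℤ) (l : ℕ), 0 < l ∧
        x = k • Φ.root i + l • Φ.root (Φ.reflectionPerm j j) then 1 else 0 : ℂ) = E' j i := by
      refine if_congr ⟨?_, ?_⟩ rfl rfl
      · rintro ⟨k, l, hl, hk⟩
        -- Since `x = kα_i - lα_j` and `f(x) > 0`, the coefficient `k` must be positive.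
        have h2 : 0 < k := by
          by_contra hk0
          have h3 : (k : ℝ) ≤ 0 := by exact_mod_cast not_lt.1 hk0
          have h4 := congrArg f hk
          rw [root_neg, map_add, map_zsmul, map_nsmul, map_neg, zsmul_eq_mul, nsmul_eq_mul] at h4
          have h5 : (0 : ℝ) ≤ l := Nat.cast_nonneg l
          nlinarith
        refine ⟨l, k.natAbs, hl, by omega, ?_⟩
        rw [hk, root_neg, ← natCast_zsmul (Φ.root i), show (k.natAbs : ℤ) = k by omega]
        module
      · rintro ⟨k, l, hk, hl, h2⟩
        exact ⟨l, k, hk, by rw [h2, root_neg]; module⟩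
    have hpos : (if ∃ (k : ℤ) (l : ℕ), 0 < l ∧
        x = k • Φ.root i + l • Φ.root j then 1 else 0 : ℂ) =
        (if ∃ k l : ℕ, 0 < k ∧ 0 < l ∧ x = k • Φ.root i + l • Φ.root j then 1 else 0 : ℂ) +
        (if ∃ l : ℕ, 0 < l ∧ x = l • Φ.root j then 1 else 0) + E' i j := by
      by_cases hx : ∃ (k : ℤ) (l : ℕ), 0 < l ∧ x = k • Φ.root i + l • Φ.root j
      · rw [if_pos hx]
        obtain ⟨k, l, hl, hk⟩ := hx
        simp only [E']
        rcases lt_trichotomy k 0 with hk0 | hk0 | hk0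
        · rw [if_neg, if_neg, if_pos]
          · simp
          · exact ⟨k.natAbs, l, by omega, hl, by
              rw [hk, ← natCast_zsmul (Φ.root i), show (k.natAbs : ℤ) = -k by omega]
              module⟩
          · rintro ⟨l', -, h0⟩
            have := huniq k 0 l l' (by rw [← hk, h0]; module)
            omega
          · rintro ⟨k', l', hk', -, h0⟩
            have := huniq k k' l l' (by rw [← hk, h0]; module)
            omega
        · subst hk0
          rw [if_neg, if_pos, if_neg]
          · simp
          · rintro ⟨k', l', hk', -, h0⟩
            have := huniq 0 (-k') l l' (by rw [← hk, h0]; module)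
            omega
          · exact ⟨l, hl, by rw [hk]; module⟩
          · rintro ⟨k', l', hk', -, h0⟩
            have := huniq 0 k' l l' (by rw [← hk, h0]; module)
            omega
        · rw [if_pos, if_neg, if_neg]
          · simp
          · rintro ⟨k', l', hk', -, h0⟩
            have := huniq k (-k') l l' (by rw [← hk, h0]; module)
            omega
          · rintro ⟨l', -, h0⟩
            have := huniq k 0 l l' (by rw [← hk, h0]; module)
            omega
          · exact ⟨k.natAbs, l, by omega, hl, by
              rw [hk, ← natCast_zsmul (Φ.root i), show (k.natAbs : ℤ) = k by omega]⟩
      · simp only [E']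
        rw [if_neg hx, if_neg, if_neg, if_neg]
        · simp
        · rintro ⟨k, l, -, hl, h0⟩
          exact hx ⟨-k, l, hl, by rw [h0]; module⟩
        · rintro ⟨l, hl, h0⟩
          exact hx ⟨0, l, hl, by rw [h0]; module⟩
        · rintro ⟨k, l, -, hl, h0⟩
          exact hx ⟨k, l, hl, by rw [h0]; module⟩
    rw [hpos, hneg, hw, ht _ _ (root_neg j)]
    module
  have hsum := Finset.sum_eq_zero hrow
  simp only [sub_smul, add_smul, Finset.sum_add_distrib, Finset.sum_sub_distrib] at hsum
  -- Wedge times commutator is symmetric in `i` and `j`, so the two difference terms agree.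
  have hswap : ∑ i ∈ posRoots b, ∑ j ∈ posRoots b, E' j i • wedge u v i j • ⁅t i, t j⁆ =
      ∑ i ∈ posRoots b, ∑ j ∈ posRoots b, E' i j • wedge u v i j • ⁅t i, t j⁆ := by
    rw [Finset.sum_comm]
    exact Finset.sum_congr rfl fun i _ => Finset.sum_congr rfl fun j _ => by
      rw [wedge_smul_lie_comm]
  rwa [hswap, add_sub_cancel_right] at hsum

end Coefficients

/-! ### Vanishing of the curvature and its constant term -/

section Flatness

variable [Φ.IsRootSystem]

theorem lie_connForm_eq_zero (ht : ∀ i j, Φ.root j = -Φ.root i → t j = t i)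
    (hs : ∀ i, StringRel Φ t i) (hτ : ∀ u v, ⁅τ u, τ v⁆ = 0)
    (hδ : ∀ i, ∀ u : Cartan Φ, u (rootWt Φ i) = 0 → ⁅t i, delta Φ b t τ u⁆ = 0)
    (u v : Cartan Φ) : ⁅connForm Φ b t τ u, connForm Φ b t τ v⁆ = 0 := by
  classical
  obtain ⟨cf, hcf⟩ := exists_isExpansion b
  obtain ⟨f, hf⟩ := exists_pos_functional b
  refine hcf.eq_zero_of_extendFunctional fun x => ?_
  refine (smul_eq_zero.1 ?_).resolve_left (two_ne_zero (α := ℂ))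
  rw [extendFunctional_lie, hτ, smul_zero, add_zero]
  have h1 : ∑ i ∈ posRoots b, ∑ j ∈ posRoots b,
      cf x (invDenom Φ i * invDenom Φ j) • wedge u v i j • ⁅t i, t j⁆ =
      ∑ i ∈ posRoots b, ∑ j ∈ posRoots b,
      (if ∃ k l : ℕ, 0 < k ∧ 0 < l ∧ x = k • Φ.root i + l • Φ.root j then 1 else 0 : ℂ) •
        wedge u v i j • ⁅t i, t j⁆ := by
    refine Finset.sum_congr rfl fun i hi => Finset.sum_congr rfl fun j hj => ?_
    by_cases hij : i = j
    · rw [hij, ring_lie_self, smul_zero, smul_zero, smul_zero]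
    · rw [hcf.invDenom_mul_eq _ _ _ ((mem_posRoots b).1 hi) ((mem_posRoots b).1 hj) hij]
  have h2 : ∑ i ∈ posRoots b, cf x (invDenom Φ i) • ⁅t i, τ (kerVec u v i)⁆ =
      ∑ i ∈ posRoots b, (if ∃ l : ℕ, 0 < l ∧ x = l • Φ.root i then 1 else 0 : ℂ) •
        ⁅t i, τ (kerVec u v i)⁆ :=
    Finset.sum_congr rfl fun i hi => by rw [hcf.invDenom_eq _ _ ((mem_posRoots b).1 hi)]
  rw [h1, h2]
  -- All exponents that occur are sums of positive roots, so only `f(x) > 0` matters.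
  by_cases hx : 0 < f x
  · rw [eq_neg_of_add_eq_zero_left (sum_pair_coeff_eq_zero ht hs hf hx u v), Finset.sum_comm,
      Finset.smul_sum, ← Finset.sum_neg_distrib, ← Finset.sum_add_distrib]
    refine Finset.sum_eq_zero fun j _ => ?_
    rw [← Finset.smul_sum, smul_comm (2 : ℂ), ← smul_neg, ← smul_add]
    have h3 := hδ j (kerVec u v j) (by
      rw [kerVec]
      change u (rootWt Φ j) • v (rootWt Φ j) - v (rootWt Φ j) • u (rootWt Φ j) = 0
      rw [smul_eq_mul, smul_eq_mul]
      ring)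
    -- Twice this commutator is exactly what the pair sum and the `τ` term contribute for `α_j`.
    have h4 : ⁅t j, delta Φ b t τ (kerVec u v j)⁆ = ⁅t j, τ (kerVec u v j)⁆ -
        (1 / 2 : ℂ) • ∑ i ∈ posRoots b, wedge u v i j • ⁅t i, t j⁆ := by
      have h5 : ∀ i, wedge u v i j • ⁅t i, t j⁆ = ⁅t j, kerVec u v j (rootWt Φ i) • t i⁆ := by
        intro i
        rw [← wedge_smul_lie_comm, ring_lie_smul]
        rfl
      simp only [h5, ← ring_lie_smul, ← ring_lie_sum]
      rw [delta]
      simp only [Ring.lie_def]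
      noncomm_ring
    rw [h4, sub_eq_zero] at h3
    rw [h3, smul_smul]
    norm_num
  · have h3 : ∀ (l : ℕ) i, i ∈ posRoots b → 0 < l → 0 < f (l • Φ.root i) := fun l i hi hl => by
      rw [map_nsmul]
      exact nsmul_pos (hf i ((mem_posRoots b).1 hi)) hl.ne'
    rw [Finset.sum_eq_zero, Finset.sum_eq_zero, smul_zero, add_zero]
    · intro i hi
      rw [if_neg, zero_smul]
      rintro ⟨l, hl, rfl⟩
      exact hx (h3 l i hi hl)
    · intro i hi
      refine Finset.sum_eq_zero fun j hj => ?_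
      rw [if_neg, zero_smul]
      rintro ⟨k, l, hk, hl, rfl⟩
      exact hx (by rw [map_add]; exact add_pos (h3 k i hi hk) (h3 l j hj hl))

/-- Every other term of the curvature is supported where `f > 0`, so its constant coefficient is
`[τ(u), τ(v)]`. -/
lemma lie_tau_eq_zero (h : ∀ u v, ⁅connForm Φ b t τ u, connForm Φ b t τ v⁆ = 0)
    (u v : Cartan Φ) : ⁅τ u, τ v⁆ = 0 := by
  classical
  obtain ⟨cf, hcf⟩ := exists_isExpansion b
  obtain ⟨f, hf⟩ := exists_pos_functional b
  have h3 : ∀ (l : ℕ) i, i ∈ posRoots b → 0 < l → 0 < f (l • Φ.root i) := fun l i hi hl => by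
    rw [map_nsmul]
    exact nsmul_pos (hf i ((mem_posRoots b).1 hi)) hl.ne'
  have h1 := extendFunctional_lie (b := b) (t := t) (τ := τ) (cf 0) u v
  rw [h, map_zero, smul_zero, hcf.one_zero, one_smul, Finset.sum_eq_zero, Finset.sum_eq_zero,
    zero_add, zero_add, eq_comm] at h1
  · exact (smul_eq_zero.1 h1).resolve_left two_ne_zero
  · intro i hi
    rw [hcf.invDenom_eq _ _ ((mem_posRoots b).1 hi), if_neg, zero_smul]
    rintro ⟨l, hl, h0⟩
    exact (h3 l i hi hl).ne (by rw [← h0, map_zero])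
  · intro i hi
    refine Finset.sum_eq_zero fun j hj => ?_
    by_cases hij : i = j
    · rw [hij, ring_lie_self, smul_zero, smul_zero]
    · rw [hcf.invDenom_mul_eq _ _ _ ((mem_posRoots b).1 hi) ((mem_posRoots b).1 hj) hij, if_neg,
        zero_smul]
      rintro ⟨k, l, hk, hl, h0⟩
      exact (add_pos (h3 k i hi hk) (h3 l j hj hl)).ne (by rw [← map_add, ← h0, map_zero])

end Flatness

end

end TrigConn

end

/-! ### The theorem -/

open Classical in
open TrigConn in
theorem mainTheorem3 {ι V E A : Type*} [Fintype ι]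
    [AddCommGroup V] [Module ℝ V] [AddCommGroup E] [Module ℝ E]
    (Φ : RootPairing ι ℝ V E) [Φ.IsRootSystem] [Φ.IsCrystallographic] [Φ.IsReduced]
    (b : Φ.Base)
    [Ring A] [Algebra ℂ A] (ρ : Φ.weylGroup →* (A ≃ₐ[ℂ] A))
    (t : ι → A) (ht : ∀ i j, Φ.root j = -Φ.root i → t j = t i)
    (τ : Cartan Φ →ₗ[ℂ] A) :
    ((IsFlat Φ (trigConn Φ b t τ) ∧ IsWeylEquivariant Φ ρ (trigConn Φ b t τ)) ↔
      (∀ Ψ : Set ι, IsRankTwoSubsystem Φ Ψ → ∀ i ∈ Ψ,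
        ⁅t i, ∑ j ∈ (posRoots b).filter (fun j => j ∈ Ψ), t j⁆ = 0) ∧
      (∀ u v, ⁅τ u, τ v⁆ = 0) ∧
      (∀ i ∈ b.support, ∀ u : Cartan Φ, u (rootWt Φ i) = 0 → ⁅t i, τ u⁆ = 0) ∧
      TEquivariant Φ b ρ t ∧ TauTwisted Φ b ρ t τ) ∧
    (IsWeylEquivariant Φ ρ (trigConn Φ b t τ) ↔
      TEquivariant Φ b ρ t ∧ TauTwisted Φ b ρ t τ) ∧
    (TEquivariant Φ b ρ t →
      (TauTwisted Φ b ρ t τ ↔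
        ∀ (w : Φ.weylGroup) (v : Cartan Φ),
          ρ w (delta Φ b t τ v) = delta Φ b t τ (weylCartan Φ w v))) := by
  refine ⟨⟨fun ⟨hflat, hequiv⟩ => ?_, fun ⟨ha, hb, hc, hd, he⟩ => ?_⟩,
    isWeylEquivariant_trigConn_iff b ρ τ ht, tauTwisted_iff_delta b ρ τ ht⟩
  · obtain ⟨hd, he⟩ := (isWeylEquivariant_trigConn_iff b ρ τ ht).1 hequiv
    obtain ⟨cf, hcf⟩ := exists_isExpansion b
    have hcomm := (isFlat_trigConn_iff Φ b t τ).1 hflat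
    have hjump := fun i (hi : i ∈ b.support) => jumpRel_of_lie_eq_zero hcf hcomm hi
    have hstring := stringRel_of_simple ht hd fun i hi => (hjump i hi).stringRel ht hi
    exact ⟨fun Ψ hΨ i hi => lie_sum_rankTwo_eq_zero ht b hstring hΨ hi, lie_tau_eq_zero hcomm,
      fun i hi => (hjump i hi).lie_eq_zero hi, hd, he⟩
  · refine ⟨(isFlat_trigConn_iff Φ b t τ).2 ?_,
      (isWeylEquivariant_trigConn_iff b ρ τ ht).2 ⟨hd, he⟩⟩
    have hstring := stringRel_of_rankTwo ht b ha
    exact lie_connForm_eq_zero ht hstring hb (lie_delta_eq_zero ht hd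
      ((tauTwisted_iff_delta b ρ τ ht hd).1 he)
      fun i hi => lie_delta_eq_zero_of_simple ht hi (hstring i) (hc i hi))
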